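/- An oriented virtual link is a class of oriented virtual link diagrams (generic immersions of one or several oriented circles in the plane, whose double points are positive, negative or virtual crossings) under the generalized Reidemeister moves (r1)–(r3), (v1)–(v4). It is a virtual knot if it has one component, and it is classical if it has a diagram without virtual crossings. Let $D$ be a diagram of a virtual link $K$. The virtual knot group $VG_K$ has one generator for each arc of $D$ (from one crossing of any kind to the next, or a whole circle without crossings), two further generators $s,q$, the relation $[s,q]=1$, and two relations for each crossing: if the crossing is drawn with both strands pointing upwards and the arcs at the bottom left and bottom right are $x$ and $y$, then the arcs at the top left and top right are $$xysx^{-1}s^{-1},\ sxs^{-1}\ \text{ (positive)};\qquad s^{-1}ys,\ s^{-1}y^{-1}sxy\ \text{ (negative)};\qquad q^{-1}yq,\ qxq^{-1}\ \text{ (virtual)}.$$ (A circle without crossings contributes a trivial relation, so that $n$ arcs give $n$ relators besides $[s,q]$.) Let $M$ be the $(n+1)\times(n+2)$ matrix over $\mathcal L=\mathbb Z[s^{\pm1},t^{\pm1},q^{\pm1}]$ of the Fox derivatives of the relators with respect to the generators, evaluated at $s\mapsto s$, $q\mapsto q$, $a\mapsto t$ for every arc $a$. The virtual Alexander polynomial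 $H_K(s,t,q)\in\mathcal L$ is a generator of the smallest principal ideal containing all $(n+1)\times(n+1)$ minors of $M$; it is defined up to units of $\mathcal L$. **Proposition.** Let $K$ be a virtual knot or link. Then $H_K(s,t,q)$ exists, and, computed from any diagram of $K$: (i) $H_K(s,t,q)$ is divisible by $q-s$ in $\mathcal L$; (ii) $H_K(s,t,q)$ is divisible by $1-tq$ in $\mathcal L$; (iii) if $K$ is a virtual knot, then $H_K(s,t,q)$ is divisible by $1-st$ in $\mathcal L$. (iv) If $K$ is a classical knot or link, then $H_K(s,t,q)=0$. -/

import Mathlib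

namespace VirtualLinks

/-! ### Virtual link diagrams -/

/-- The three kinds of double points of an oriented virtual link diagram. -/
inductive Kind
  | pos
  | neg
  | virt
  deriving DecidableEq

/-- A positive and a negative crossing are opposite to each other; a virtual crossing is opposite
to itself. -/
def Kind.opp : Kind → Kind
  | pos => neg
  | neg => pos
  | virt => virt

/-- Vertices of a diagram are crossings `X` and bivalent marked points `P` on the strands.
Draw each crossing so that both of its strands point upwards. It has two incoming ends,
bottom left `(x, false)` and bottom right `(x, true)`, and two outgoing ends, top left `(x, false)`
and top right `(x, true)`. A marked point has one incoming and one outgoing end.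
So `Port P X` indexes the incoming ends and it also indexes the outgoing ends. -/
abbrev Port (P X : Type) : Type := P ⊕ X × Bool

/-- An oriented 4-valent diagram (with some marked points on its edges, which are there so
that circles without crossings are included), recorded by its vertices and edges with the cyclic
order of the ends at each vertex. It need not be planar. Every edge leads from an outgoing end `p`
to the incoming end `next p`. -/
structure PreDiagram where
  Pt : Type
  Xing : Type
  [fintypePt : Fintype Pt]
  [fintypeXing : Fintype Xing]
  kind : Xing → Kind
  next : Equiv.Perm (Port Pt Xing)

attribute [instance] PreDiagram.fintypePt PreDiagram.fintypeXing

namespace PreDiagram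

variable (D : PreDiagram)

/-- The edges, indexed by the outgoing ends where they begin. -/
abbrev Arc : Type := Port D.Pt D.Xing

/-- The edge that arrives at a given incoming end. -/
def incoming (p : Port D.Pt D.Xing) : D.Arc := D.next.symm p

/-- Half-edges: `inl p` is the outgoing end `p`, and `inr p` is the incoming end `p`. -/
abbrev Dart : Type := Port D.Pt D.Xing ⊕ Port D.Pt D.Xing

/-- The two halves of an edge are exchanged. -/
def edgeFlip : Equiv.Perm D.Dart where
  toFun := Sum.elim (fun p => Sum.inr (D.next p)) (fun p => Sum.inl (D.next.symm p))
  invFun := Sum.elim (fun p => Sum.inr (D.next p)) (fun p => Sum.inl (D.next.symm p))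
  left_inv := by rintro (p | p) <;> simp
  right_inv := by rintro (p | p) <;> simp

/-- The half-edge that follows counterclockwise around the vertex. At a crossing, the order is
bottom left, bottom right, top right, top left. -/
def rotation : Equiv.Perm D.Dart where
  toFun
    | .inl (.inl v) => .inr (.inl v)
    | .inr (.inl v) => .inl (.inl v)
    | .inr (.inr (x, false)) => .inr (.inr (x, true))
    | .inr (.inr (x, true)) => .inl (.inr (x, true))
    | .inl (.inr (x, true)) => .inl (.inr (x, false))
    | .inl (.inr (x, false)) => .inr (.inr (x, false))
  invFun
    | .inr (.inl v) => .inl (.inl v)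
    | .inl (.inl v) => .inr (.inl v)
    | .inr (.inr (x, true)) => .inr (.inr (x, false))
    | .inl (.inr (x, true)) => .inr (.inr (x, true))
    | .inl (.inr (x, false)) => .inl (.inr (x, true))
    | .inr (.inr (x, false)) => .inl (.inr (x, false))
  left_inv := by rintro ((v | ⟨x, _ | _⟩) | (v | ⟨x, _ | _⟩)) <;> rfl
  right_inv := by rintro ((v | ⟨x, _ | _⟩) | (v | ⟨x, _ | _⟩)) <;> rfl

/-- The number of faces of the surface that is obtained by gluing a disc to each boundary walk. -/
noncomputable def numFaces : ℕ :=
  Nat.card (Quotient (Equiv.Perm.SameCycle.setoid (D.rotation * D.edgeFlip)))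

/-- The number of connected components of the underlying graph. -/
noncomputable def numPieces : ℕ :=
  Nat.card (MulAction.orbitRel.Quotient (Subgroup.closure {D.rotation, D.edgeFlip}) D.Dart)

/-- The diagram can be drawn in the plane: by Euler's formula, every connected piece of the
underlying graph, with the given cyclic orders at its vertices, has genus zero. -/
def IsPlanar : Prop :=
  Fintype.card D.Pt + Fintype.card D.Xing + D.numFaces = Fintype.card D.Arc + 2 * D.numPieces

/-- The outgoing end that is opposite to an incoming end. -/
def opposite : Equiv.Perm (Port D.Pt D.Xing) :=
  Equiv.sumCongr (Equiv.refl _) (Equiv.prodCongr (Equiv.refl _) Equiv.boolNot)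

/-- Following the strands, all edges are met in a single circuit: the diagram is an immersion
of one circle. -/
def HasOneComponent : Prop :=
  ∀ p p' : D.Arc, (D.opposite * D.next).SameCycle p p'

end PreDiagram

/-! ### Generalized Reidemeister moves -/

/-- A tangle with `m` oriented strands, `np` marked points and crossings indexed by `Fin nx`.
The element `Sum.inl j` stands for the place where strand `j` enters the tangle and also for the
place where it leaves the tangle: `conn` maps each outgoing end, and each entrance, to
the incoming end or the exit to which it is joined. -/
structure Tangle (m : ℕ) where
  np : ℕ
  nx : ℕ
  kind : Fin nx → Kind
  conn : Equiv.Perm (Fin m ⊕ Port (Fin np) (Fin nx))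

/-- The entrances of a tangle and its ends, inside the diagram where it is inserted on the
edges `a j`. -/
def insertEmbedding (D : PreDiagram) {m : ℕ} (a : Fin m ↪ D.Arc) (T : Tangle m) :
    (Fin m ⊕ Port (Fin T.np) (Fin T.nx)) ↪ Port (D.Pt ⊕ Fin T.np) (D.Xing ⊕ Fin T.nx) where
  toFun := Sum.elim (fun j => Sum.map Sum.inl (Prod.map Sum.inl id) (a j))
    (Sum.map Sum.inr (Prod.map Sum.inr id))
  inj' := by
    have h1 : Function.Injective (Sum.map Sum.inl (Prod.map Sum.inl id) :
        Port D.Pt D.Xing → Port (D.Pt ⊕ Fin T.np) (D.Xing ⊕ Fin T.nx)) :=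
      Sum.map_injective.2 ⟨Sum.inl_injective, Sum.inl_injective.prodMap Function.injective_id⟩
    have h2 : Function.Injective (Sum.map Sum.inr (Prod.map Sum.inr id) :
        Port (Fin T.np) (Fin T.nx) → Port (D.Pt ⊕ Fin T.np) (D.Xing ⊕ Fin T.nx)) :=
      Sum.map_injective.2 ⟨Sum.inr_injective, Sum.inr_injective.prodMap Function.injective_id⟩
    refine (h1.comp a.injective).sumElim h2 ?_
    intro j p
    simp only [Function.comp]
    rcases a j with v | ⟨x, b⟩ <;> rcases p with w | ⟨y, c⟩ <;> simp

/-- The ends of a diagram inside the diagram where a tangle has been inserted. -/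
def oldEmbedding (D : PreDiagram) {m : ℕ} (T : Tangle m) :
    Port D.Pt D.Xing ↪ Port (D.Pt ⊕ Fin T.np) (D.Xing ⊕ Fin T.nx) where
  toFun := Sum.map Sum.inl (Prod.map Sum.inl id)
  inj' := Sum.map_injective.2
    ⟨Sum.inl_injective, Sum.inl_injective.prodMap Function.injective_id⟩

/-- The diagram obtained from `D` by cutting its edges `a 0, …, a (m-1)` and inserting the
tangle `T`: the edge `a j` now enters `T` as strand `j`, and the exit of strand `j` is joined to the
end at which `a j` used to arrive. -/
noncomputable def PreDiagram.insert (D : PreDiagram) {m : ℕ} (a : Fin m ↪ D.Arc) (T : Tangle m) :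
    PreDiagram where
  Pt := D.Pt ⊕ Fin T.np
  Xing := D.Xing ⊕ Fin T.nx
  kind := Sum.elim D.kind T.kind
  next := D.next.viaEmbedding (oldEmbedding D T) * T.conn.viaEmbedding (insertEmbedding D a T)

namespace Tangle

/-- Entrance and exit of a strand. -/
abbrev strand {m p x : ℕ} (j : Fin m) : Fin m ⊕ Port (Fin p) (Fin x) := .inl j

/-- Left ends of a crossing. -/
abbrev left {m p x : ℕ} (c : Fin x) : Fin m ⊕ Port (Fin p) (Fin x) := .inr (.inr (c, false))

/-- Right ends of a crossing. -/
abbrev right {m p x : ℕ} (c : Fin x) : Fin m ⊕ Port (Fin p) (Fin x) := .inr (.inr (c, true))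

/-- One strand with a marked point. -/
def point : Tangle 1 where
  np := 1
  nx := 0
  kind := Fin.elim0
  conn := Equiv.swap (strand 0) (.inr (.inl 0))

/-- One strand with a kink, the small loop being on the right of the crossing. -/
def kinkRight (k : Kind) : Tangle 1 where
  np := 0
  nx := 1
  kind := fun _ => k
  conn := Equiv.swap (strand 0) (left 0)

/-- One strand with a kink, the small loop being on the left of the crossing. -/
def kinkLeft (k : Kind) : Tangle 1 where
  np := 0
  nx := 1
  kind := fun _ => k
  conn := Equiv.swap (strand 0) (right 0)

/-- Two strands in the same direction that cross at `0` and then at `1`. -/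
def bigonParallel (k : Kind) : Tangle 2 where
  np := 0
  nx := 2
  kind := ![k, k.opp]
  conn := List.formPerm [strand 0, left 0, left 1] * List.formPerm [strand 1, right 0, right 1]

/-- Two strands in opposite directions with two crossings; strand `0` passes `0` and then `1`,
strand `1` passes `1` and then `0`, and the bigon is on their right. -/
def bigonRight (k : Kind) : Tangle 2 where
  np := 0
  nx := 2
  kind := ![k, k.opp]
  conn := List.formPerm [strand 0, left 0, strand 1, left 1] * List.formPerm [right 0, right 1]

/-- As `bigonRight`, with the bigon on the left of the strands. -/
def bigonLeft (k : Kind) : Tangle 2 where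
  np := 0
  nx := 2
  kind := ![k, k.opp]
  conn := List.formPerm [strand 0, right 0, strand 1, right 1] * List.formPerm [left 0, left 1]

/-- Three strands that run upwards and start in the order `0, 1, 2` from left to right. The crossings
`0`, `1`, `2` are those of the strands `01`, `02`, `12`, and they are passed in this order from
bottom to top. -/
def braidTriangle (k : Fin 3 → Kind) : Tangle 3 where
  np := 0
  nx := 3
  kind := k
  conn := List.formPerm [strand 0, left 0, left 2, strand 2, right 1] *
    List.formPerm [strand 1, right 0, left 1, right 2]

/-- As `braidTriangle`, but the crossings are passed in the order `2, 1, 0`. -/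
def braidTriangle' (k : Fin 3 → Kind) : Tangle 3 where
  np := 0
  nx := 3
  kind := k
  conn := List.formPerm [strand 0, left 1, strand 2, right 2, right 0] *
    List.formPerm [strand 1, left 2, right 1, left 0]

/-- Three strands that bound a triangle on their right. The crossings `0`, `1`, `2` are those of
the strands `02`, `01`, `12`. -/
def cyclicTriangle (k : Fin 3 → Kind) : Tangle 3 where
  np := 0
  nx := 3
  kind := k
  conn := List.formPerm [strand 0, left 0, strand 2, left 2, strand 1, left 1] *
    List.formPerm [right 0, right 1, right 2]

/-- As `cyclicTriangle`, with the triangle on the left of the strands. -/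
def cyclicTriangle' (k : Fin 3 → Kind) : Tangle 3 where
  np := 0
  nx := 3
  kind := k
  conn := List.formPerm [strand 0, right 1, strand 1, right 2, strand 2, right 0] *
    List.formPerm [left 1, left 0, left 2]

end Tangle

/-- The crossings of a triangle of type `braidTriangle` can be moved across each other: either all
three are classical and the strands lie at three different heights, or all three
are virtual, or exactly two are virtual. -/
def BraidAllowed (k : Fin 3 → Kind) : Prop :=
  ((∀ i, k i ≠ .virt) ∧ k ≠ ![.pos, .neg, .pos] ∧ k ≠ ![.neg, .pos, .neg]) ∨
    ∃ i, ∀ j, j ≠ i → k j = .virt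

/-- The same for triangles of type `cyclicTriangle`. -/
def CyclicAllowed (k : Fin 3 → Kind) : Prop :=
  ((∀ i, k i ≠ .virt) ∧ k ≠ ![.pos, .pos, .pos] ∧ k ≠ ![.neg, .neg, .neg]) ∨
    ∃ i, ∀ j, j ≠ i → k j = .virt

/-- The generalized Reidemeister moves in all their oriented versions. The moves of type
`kink` are (r1) and (v1), those of type `bigon` are (r2) and (v2), and those of
type `triangle` are (r3), (v3) and (v4). Renaming vertices and placing
marked points does not change what is drawn. -/
inductive Move : PreDiagram → PreDiagram → Prop
  | rename (D E : PreDiagram) (e : D.Pt ≃ E.Pt) (f : D.Xing ≃ E.Xing)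
      (hkind : ∀ x, E.kind (f x) = D.kind x)
      (hnext : ∀ p, E.next (Sum.map e (Prod.map f id) p) = Sum.map e (Prod.map f id) (D.next p)) :
      Move D E
  | point (D : PreDiagram) (a : Fin 1 ↪ D.Arc) : Move D (D.insert a .point)
  | kinkRight (D : PreDiagram) (a : Fin 1 ↪ D.Arc) (k : Kind) : Move D (D.insert a (.kinkRight k))
  | kinkLeft (D : PreDiagram) (a : Fin 1 ↪ D.Arc) (k : Kind) : Move D (D.insert a (.kinkLeft k))
  | bigonParallel (D : PreDiagram) (a : Fin 2 ↪ D.Arc) (k : Kind) :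
      Move D (D.insert a (.bigonParallel k))
  | bigonRight (D : PreDiagram) (a : Fin 2 ↪ D.Arc) (k : Kind) :
      Move D (D.insert a (.bigonRight k))
  | bigonLeft (D : PreDiagram) (a : Fin 2 ↪ D.Arc) (k : Kind) :
      Move D (D.insert a (.bigonLeft k))
  | braidTriangle (D : PreDiagram) (a : Fin 3 ↪ D.Arc) (k : Fin 3 → Kind) (hk : BraidAllowed k) :
      Move (D.insert a (.braidTriangle k)) (D.insert a (.braidTriangle' k))
  | cyclicTriangle (D : PreDiagram) (a : Fin 3 ↪ D.Arc) (k : Fin 3 → Kind) (hk : CyclicAllowed k) :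
      Move (D.insert a (.cyclicTriangle k)) (D.insert a (.cyclicTriangle' k))

/-- An oriented virtual link diagram: a generic immersion of one or several oriented circles in the
plane, each double point being a positive, negative or virtual crossing. -/
structure Diagram extends PreDiagram where
  nonempty : Nonempty toPreDiagram.Arc
  planar : toPreDiagram.IsPlanar

/-- An oriented virtual link: a class of virtual link diagrams for the equivalence relation that the
generalized Reidemeister moves generate. -/
def VirtualLink : Type 1 :=
  Quot fun D E : Diagram => Move D.toPreDiagram E.toPreDiagram

/-- The virtual link that a diagram represents. -/
def Diagram.toLink (D : Diagram) : VirtualLink := Quot.mk _ D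

/-- A virtual knot is a virtual link with one component. -/
def VirtualLink.IsKnot (K : VirtualLink) : Prop :=
  ∃ D : Diagram, D.toLink = K ∧ D.HasOneComponent

/-- A virtual link is classical if it has a diagram without virtual crossings. -/
def VirtualLink.IsClassical (K : VirtualLink) : Prop :=
  ∃ D : Diagram, D.toLink = K ∧ ∀ x, D.kind x ≠ Kind.virt

/-! ### The virtual knot group -/

/-- The generators of the virtual knot group: the arcs and two auxiliary generators. -/
inductive Gen (A : Type) : Type
  | arc (a : A)
  | s
  | q

namespace PreDiagram

variable (D : PreDiagram)

/-- The relators, one for each outgoing end and the last one for `[s, q]`. At a crossing with incoming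
arcs `x` (left) and `y` (right), the outgoing arcs are
* `x y s x⁻¹ s⁻¹` (left) and `s x s⁻¹` (right) if it is positive,
* `s⁻¹ y s` (left) and `s⁻¹ y⁻¹ s x y` (right) if it is negative,
* `q⁻¹ y q` (left) and `q x q⁻¹` (right) if it is virtual.

The arcs on the two sides of a marked point are equal. -/
def relator : Option D.Arc → FreeGroup (Gen D.Arc)
  | none =>
    FreeGroup.of .s * FreeGroup.of .q * (FreeGroup.of .s)⁻¹ * (FreeGroup.of .q)⁻¹
  | some (.inl v) =>
    FreeGroup.of (.arc (D.incoming (.inl v))) * (FreeGroup.of (.arc (.inl v)))⁻¹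
  | some (.inr (c, b)) =>
    let x : FreeGroup (Gen D.Arc) := FreeGroup.of (.arc (D.incoming (.inr (c, false))))
    let y : FreeGroup (Gen D.Arc) := FreeGroup.of (.arc (D.incoming (.inr (c, true))))
    let s : FreeGroup (Gen D.Arc) := FreeGroup.of .s
    let q : FreeGroup (Gen D.Arc) := FreeGroup.of .q
    let out : FreeGroup (Gen D.Arc) := FreeGroup.of (.arc (.inr (c, b)))
    (match D.kind c, b with
      | .pos, false => x * y * s * x⁻¹ * s⁻¹
      | .pos, true => s * x * s⁻¹
      | .neg, false => s⁻¹ * y * s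
      | .neg, true => s⁻¹ * y⁻¹ * s * x * y
      | .virt, false => q⁻¹ * y * q
      | .virt, true => q * x * q⁻¹) * out⁻¹

/-- The virtual knot group. -/
abbrev VirtualKnotGroup : Type := PresentedGroup (Set.range D.relator)

end PreDiagram

/-! ### Fox calculus and the virtual Alexander polynomial -/

section Fox

variable {G : Type}

open Classical in
/-- The Fox derivative `∂w/∂g` of a word `w` in letters `(h, true) = h` and `(h, false) = h⁻¹`. -/
noncomputable def foxWord (g : G) : List (G × Bool) → MonoidAlgebra ℤ (FreeGroup G)
  | [] => 0
  | (h, true) :: w =>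
    (if h = g then 1 else 0) + MonoidAlgebra.of ℤ _ (FreeGroup.of h) * foxWord g w
  | (h, false) :: w =>
    MonoidAlgebra.of ℤ _ (FreeGroup.of h)⁻¹ * (-(if h = g then 1 else 0) + foxWord g w)

theorem foxWord_step (g : G) {u v : List (G × Bool)} (h : FreeGroup.Red.Step u v) :
    foxWord g u = foxWord g v := by
  obtain ⟨⟩ := h
  rename_i l r h b
  induction l with
  | nil =>
    have h1 : MonoidAlgebra.of ℤ (FreeGroup G) (FreeGroup.of h) *
        MonoidAlgebra.of ℤ (FreeGroup G) (FreeGroup.of h)⁻¹ = 1 := by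
      rw [← map_mul, mul_inv_cancel, map_one]
    have h2 : MonoidAlgebra.of ℤ (FreeGroup G) (FreeGroup.of h)⁻¹ *
        MonoidAlgebra.of ℤ (FreeGroup G) (FreeGroup.of h) = 1 := by
      rw [← map_mul, inv_mul_cancel, map_one]
    cases b
    · simp only [List.nil_append, Bool.not_false, foxWord]
      rw [neg_add_cancel_left, ← mul_assoc, h2, one_mul]
    · simp only [List.nil_append, Bool.not_true, foxWord]
      rw [← mul_assoc, h1, one_mul, add_neg_cancel_left]
  | cons a l ih =>
    obtain ⟨c, _ | _⟩ := a <;> simp only [List.cons_append, foxWord, ih]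

/-- The Fox derivative `∂w/∂g` of an element `w` of the free group, in its integral group ring. -/
noncomputable def fox (g : G) : FreeGroup G → MonoidAlgebra ℤ (FreeGroup G) :=
  Quot.lift (foxWord g) fun _ _ h => foxWord_step g h

end Fox

/-- The ring `ℤ[s^{±1}, t^{±1}, q^{±1}]` of Laurent polynomials, as the group ring of `ℤ³`. -/
abbrev Laurent : Type := MonoidAlgebra ℤ (Multiplicative (Fin 3 → ℤ))

/-- The standard generators of `ℤ³`, written multiplicatively. -/
def unitVec (i : Fin 3) : Multiplicative (Fin 3 → ℤ) := Multiplicative.ofAdd (Pi.single i 1)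

/-- The variable `s`. -/
noncomputable def varS : Laurent := MonoidAlgebra.of ℤ _ (unitVec 0)

/-- The variable `t`. -/
noncomputable def varT : Laurent := MonoidAlgebra.of ℤ _ (unitVec 1)

/-- The variable `q`. -/
noncomputable def varQ : Laurent := MonoidAlgebra.of ℤ _ (unitVec 2)

/-- The homomorphism to `ℤ³` with `s ↦ s`, `q ↦ q`, and `a ↦ t` for every arc `a`. -/
def abelianize (A : Type) : FreeGroup (Gen A) →* Multiplicative (Fin 3 → ℤ) :=
  FreeGroup.lift fun
    | .arc _ => unitVec 1
    | .s => unitVec 0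
    | .q => unitVec 2

namespace PreDiagram

variable (D : PreDiagram)

/-- The matrix of the Fox derivatives of the relators of the virtual knot group with respect to all
generators, with entries
in the ring of Laurent polynomials. -/
noncomputable def alexanderMatrix : Matrix (Option D.Arc) (Gen D.Arc) Laurent :=
  fun r g => MonoidAlgebra.mapDomainRingHom ℤ (abelianize D.Arc) (fox g (D.relator r))

/-- The 0-th elementary ideal: with `n` arcs, the matrix has `n + 1` rows and `n + 2` columns, and
the ideal is generated by its minors of size `n + 1`. -/
noncomputable def elementaryIdeal : Ideal Laurent :=
  Ideal.span {d | ∃ (f : Fin (Fintype.card D.Arc + 1) ↪ Option D.Arc)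
    (g : Fin (Fintype.card D.Arc + 1) ↪ Gen D.Arc), d = (D.alexanderMatrix.submatrix f g).det}

end PreDiagram

/-- `H` generates the smallest principal ideal that contains the ideal `I`; in other words, `H` is a
greatest common divisor of any set of generators of `I`. -/
def IsPrincipalHull (I : Ideal Laurent) (H : Laurent) : Prop :=
  I ≤ Ideal.span {H} ∧ ∀ f : Laurent, I ≤ Ideal.span {f} → Ideal.span {H} ≤ Ideal.span {f}

/-- `H` is the virtual Alexander polynomial `H_K(s, t, q)` (which is defined up to units), computed
from some diagram of `K`. -/
def VirtualLink.IsAlexanderPolynomial (K : VirtualLink) (H : Laurent) : Prop :=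
  ∃ D : Diagram, D.toLink = K ∧ IsPrincipalHull D.elementaryIdeal H

end VirtualLinks

/-! On the arc columns, the Fox derivatives are the equations of linear colourings: each crossing
expresses its two outgoing colours linearly through its incoming ones. Let Δ be the determinant of
this square system (`alexanderDet`). The row of [s,q] vanishes on the arcs and has entries 1 - q and
s - 1 in the columns s and q, so two of the maximal minors are, up to sign, Δ(1 - q) and Δ(s - 1).
The vector with entries g - 1 lies in the kernel of the matrix, and this makes every other maximal
minor a multiple of Δ. As s - 1 and q - 1 are coprime, Δ itself is the required generator
(`isPrincipalHull_alexanderDet`), and the divisibilities become statements about zeros of Δ.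

Planarity, through Euler's formula, makes every cycle a boundary. The sum of all arcs is a cycle,
which yields an integer numbering l of the arcs that rises by one from left to right at every
crossing (`IsPlanar.exists_isNumbering`). At q = s the powers s^l form a nonzero colouring. At t =
1/q the powers q^(-l) are a left null vector of the system. At st = 1 every crossing merely
multiplies the colour of each strand by a unit, and the two factors at a crossing cancel; on a
single circuit this gives a colouring by units. So Δ vanishes under each of the three substitutions,
and `dvd_of_substitution_eq_zero` turns this into divisibility.

Without virtual crossings Δ does not involve q, so the zero at q = s forces Δ = 0. To carry this
from the classical diagram to any other one, the dimension of the colouring space over a field is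
shown to be invariant under all moves (`Diagram.finrank_colourings_eq`). The same invariant at s = t
= q = 1 detects whether there is one component, as needed for knots. -/

namespace VirtualLinks

/-! ### Linear crossing rules and colourings of tangles -/

/-- The linear rule for the colours of the outgoing ends of a crossing, in terms of the colours
`x` and `y` of its incoming ends (left and right). -/
def crossOut {R : Type*} [CommRing R] (s t q : Rˣ) : Kind → Bool → R → R → R
  | .pos, false, x, y => (1 - t * s) * x + t * y
  | .pos, true, x, _ => s * x
  | .neg, false, _, y => ↑s⁻¹ * y
  | .neg, true, x, y => ↑t⁻¹ * x + (1 - ↑s⁻¹ * ↑t⁻¹) * y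
  | .virt, false, _, y => ↑q⁻¹ * y
  | .virt, true, x, _ => q * x

/-- The colours of all outgoing ends in terms of the colours of the incoming ends. -/
def vertexOut {R : Type*} [CommRing R] (s t q : Rˣ) {P X : Type} (k : X → Kind)
    (c : Port P X → R) : Port P X → R
  | .inl v => c (.inl v)
  | .inr (x, b) => crossOut s t q (k x) b (c (.inr (x, false))) (c (.inr (x, true)))

namespace Tangle

/-- The colours `u` of the inner edges of a tangle are compatible with the colours `i` of the
entrances and `o` of the exits. -/
def Transmits {R : Type*} [CommRing R] (s t q : Rˣ) {m : ℕ} (T : Tangle m) (i o : Fin m → R)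
    (u : Port (Fin T.np) (Fin T.nx) → R) : Prop :=
  (∀ p, u p = vertexOut s t q T.kind (fun p' => Sum.elim i u (T.conn.symm (.inr p'))) p) ∧
    ∀ j, o j = Sum.elim i u (T.conn.symm (.inl j))

section
variable {R : Type*} [CommRing R] {s t q : Rˣ}

/-- The connections of the tangles are products of cycles, whose inverses are awkward to evaluate.
Here `src` is an explicit table of the inverse, which needs only a decidable check. -/
theorem transmits_mk_iff (m np nx : ℕ) {k : Fin nx → Kind}
    {conn : Equiv.Perm (Fin m ⊕ Port (Fin np) (Fin nx))}
    (src : Fin m ⊕ Port (Fin np) (Fin nx) → Fin m ⊕ Port (Fin np) (Fin nx))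
    (h : ∀ z, conn (src z) = z) {i o : Fin m → R} {u : Port (Fin np) (Fin nx) → R} :
    Transmits s t q ⟨np, nx, k, conn⟩ i o u ↔
      (∀ v, u (.inl v) = Sum.elim i u (src (.inr (.inl v)))) ∧
      (∀ c b, u (.inr (c, b)) = crossOut s t q (k c) b
        (Sum.elim i u (src (left c))) (Sum.elim i u (src (right c)))) ∧
      ∀ j, o j = Sum.elim i u (src (strand j)) := by
  have h' (z) : conn.symm z = src z := by rw [Equiv.symm_apply_eq, h]
  unfold Transmits
  simp only [h', Sum.forall, Prod.forall, vertexOut, and_assoc]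

theorem point_transmits_iff {i o : Fin 1 → R} {u : Port (Fin 1) (Fin 0) → R} :
    point.Transmits s t q i o u ↔ u (.inl 0) = i 0 ∧ o 0 = u (.inl 0) := by
  refine (transmits_mk_iff 1 1 0 (fun
    | .inl 0 => .inr (.inl 0)
    | .inr (.inl 0) => strand 0) (by decide)).trans ?_
  simp [Fin.forall_fin_succ, Sum.elim]

theorem kinkRight_transmits_iff {k : Kind} {i o : Fin 1 → R} {u : Port (Fin 0) (Fin 1) → R} :
    (kinkRight k).Transmits s t q i o u ↔
      u (.inr (0, false)) = crossOut s t q k false (i 0) (u (.inr (0, true))) ∧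
      u (.inr (0, true)) = crossOut s t q k true (i 0) (u (.inr (0, true))) ∧
      o 0 = u (.inr (0, false)) := by
  refine (transmits_mk_iff 1 0 1 (fun
    | .inl 0 => left 0
    | .inr (.inr (0, false)) => strand 0
    | .inr (.inr (0, true)) => right 0) (by decide)).trans ?_
  simp [Fin.forall_fin_succ, Sum.elim, and_assoc]

theorem kinkLeft_transmits_iff {k : Kind} {i o : Fin 1 → R} {u : Port (Fin 0) (Fin 1) → R} :
    (kinkLeft k).Transmits s t q i o u ↔
      u (.inr (0, false)) = crossOut s t q k false (u (.inr (0, false))) (i 0) ∧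
      u (.inr (0, true)) = crossOut s t q k true (u (.inr (0, false))) (i 0) ∧
      o 0 = u (.inr (0, true)) := by
  refine (transmits_mk_iff 1 0 1 (fun
    | .inl 0 => right 0
    | .inr (.inr (0, true)) => strand 0
    | .inr (.inr (0, false)) => left 0) (by decide)).trans ?_
  simp [Fin.forall_fin_succ, Sum.elim, and_assoc]

theorem bigonParallel_transmits_iff {k : Kind} {i o : Fin 2 → R}
    {u : Port (Fin 0) (Fin 2) → R} :
    (bigonParallel k).Transmits s t q i o u ↔
      u (.inr (0, false)) = crossOut s t q k false (i 0) (i 1) ∧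
      u (.inr (0, true)) = crossOut s t q k true (i 0) (i 1) ∧
      u (.inr (1, false)) =
        crossOut s t q k.opp false (u (.inr (0, false))) (u (.inr (0, true))) ∧
      u (.inr (1, true)) =
        crossOut s t q k.opp true (u (.inr (0, false))) (u (.inr (0, true))) ∧
      o 0 = u (.inr (1, false)) ∧ o 1 = u (.inr (1, true)) := by
  refine (transmits_mk_iff 2 0 2 (fun
    | .inl 0 => left 1
    | .inl 1 => right 1
    | .inr (.inr (0, false)) => strand 0
    | .inr (.inr (0, true)) => strand 1
    | .inr (.inr (1, false)) => left 0
    | .inr (.inr (1, true)) => right 0) (by decide)).trans ?_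
  simp [Fin.forall_fin_succ, Sum.elim, and_assoc]

theorem bigonRight_transmits_iff {k : Kind} {i o : Fin 2 → R}
    {u : Port (Fin 0) (Fin 2) → R} :
    (bigonRight k).Transmits s t q i o u ↔
      u (.inr (0, false)) = crossOut s t q k false (i 0) (u (.inr (1, true))) ∧
      u (.inr (0, true)) = crossOut s t q k true (i 0) (u (.inr (1, true))) ∧
      u (.inr (1, false)) = crossOut s t q k.opp false (i 1) (u (.inr (0, true))) ∧
      u (.inr (1, true)) = crossOut s t q k.opp true (i 1) (u (.inr (0, true))) ∧
      o 0 = u (.inr (1, false)) ∧ o 1 = u (.inr (0, false)) := by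
  refine (transmits_mk_iff 2 0 2 (fun
    | .inl 0 => left 1
    | .inl 1 => left 0
    | .inr (.inr (0, false)) => strand 0
    | .inr (.inr (0, true)) => right 1
    | .inr (.inr (1, false)) => strand 1
    | .inr (.inr (1, true)) => right 0) (by decide)).trans ?_
  simp [Fin.forall_fin_succ, Sum.elim, and_assoc]

theorem bigonLeft_transmits_iff {k : Kind} {i o : Fin 2 → R}
    {u : Port (Fin 0) (Fin 2) → R} :
    (bigonLeft k).Transmits s t q i o u ↔
      u (.inr (0, false)) = crossOut s t q k false (u (.inr (1, false))) (i 0) ∧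
      u (.inr (0, true)) = crossOut s t q k true (u (.inr (1, false))) (i 0) ∧
      u (.inr (1, false)) = crossOut s t q k.opp false (u (.inr (0, false))) (i 1) ∧
      u (.inr (1, true)) = crossOut s t q k.opp true (u (.inr (0, false))) (i 1) ∧
      o 0 = u (.inr (1, true)) ∧ o 1 = u (.inr (0, true)) := by
  refine (transmits_mk_iff 2 0 2 (fun
    | .inl 0 => right 1
    | .inl 1 => right 0
    | .inr (.inr (0, false)) => left 1
    | .inr (.inr (0, true)) => strand 0
    | .inr (.inr (1, false)) => left 0
    | .inr (.inr (1, true)) => strand 1) (by decide)).trans ?_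
  simp [Fin.forall_fin_succ, Sum.elim, and_assoc]

theorem braidTriangle_transmits_iff {k : Fin 3 → Kind} {i o : Fin 3 → R}
    {u : Port (Fin 0) (Fin 3) → R} :
    (braidTriangle k).Transmits s t q i o u ↔
      u (.inr (0, false)) = crossOut s t q (k 0) false (i 0) (i 1) ∧
      u (.inr (0, true)) = crossOut s t q (k 0) true (i 0) (i 1) ∧
      u (.inr (1, false)) = crossOut s t q (k 1) false (u (.inr (0, true))) (i 2) ∧
      u (.inr (1, true)) = crossOut s t q (k 1) true (u (.inr (0, true))) (i 2) ∧
      u (.inr (2, false)) =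
        crossOut s t q (k 2) false (u (.inr (0, false))) (u (.inr (1, false))) ∧
      u (.inr (2, true)) =
        crossOut s t q (k 2) true (u (.inr (0, false))) (u (.inr (1, false))) ∧
      o 0 = u (.inr (1, true)) ∧ o 1 = u (.inr (2, true)) ∧ o 2 = u (.inr (2, false)) := by
  refine (transmits_mk_iff 3 0 3 (fun
    | .inl 0 => right 1
    | .inl 1 => right 2
    | .inl 2 => left 2
    | .inr (.inr (0, false)) => strand 0
    | .inr (.inr (0, true)) => strand 1
    | .inr (.inr (1, false)) => right 0
    | .inr (.inr (1, true)) => strand 2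
    | .inr (.inr (2, false)) => left 0
    | .inr (.inr (2, true)) => left 1) (by decide)).trans ?_
  simp [Fin.forall_fin_succ, Sum.elim, and_assoc]

theorem braidTriangle'_transmits_iff {k : Fin 3 → Kind} {i o : Fin 3 → R}
    {u : Port (Fin 0) (Fin 3) → R} :
    (braidTriangle' k).Transmits s t q i o u ↔
      u (.inr (0, false)) =
        crossOut s t q (k 0) false (u (.inr (1, true))) (u (.inr (2, true))) ∧
      u (.inr (0, true)) =
        crossOut s t q (k 0) true (u (.inr (1, true))) (u (.inr (2, true))) ∧
      u (.inr (1, false)) = crossOut s t q (k 1) false (i 0) (u (.inr (2, false))) ∧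
      u (.inr (1, true)) = crossOut s t q (k 1) true (i 0) (u (.inr (2, false))) ∧
      u (.inr (2, false)) = crossOut s t q (k 2) false (i 1) (i 2) ∧
      u (.inr (2, true)) = crossOut s t q (k 2) true (i 1) (i 2) ∧
      o 0 = u (.inr (0, true)) ∧ o 1 = u (.inr (0, false)) ∧ o 2 = u (.inr (1, false)) := by
  refine (transmits_mk_iff 3 0 3 (fun
    | .inl 0 => right 0
    | .inl 1 => left 0
    | .inl 2 => left 1
    | .inr (.inr (0, false)) => right 1
    | .inr (.inr (0, true)) => right 2
    | .inr (.inr (1, false)) => strand 0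
    | .inr (.inr (1, true)) => left 2
    | .inr (.inr (2, false)) => strand 1
    | .inr (.inr (2, true)) => strand 2) (by decide)).trans ?_
  simp [Fin.forall_fin_succ, Sum.elim, and_assoc]

theorem cyclicTriangle_transmits_iff {k : Fin 3 → Kind} {i o : Fin 3 → R}
    {u : Port (Fin 0) (Fin 3) → R} :
    (cyclicTriangle k).Transmits s t q i o u ↔
      u (.inr (0, false)) = crossOut s t q (k 0) false (i 0) (u (.inr (2, true))) ∧
      u (.inr (0, true)) = crossOut s t q (k 0) true (i 0) (u (.inr (2, true))) ∧
      u (.inr (1, false)) = crossOut s t q (k 1) false (i 1) (u (.inr (0, true))) ∧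
      u (.inr (1, true)) = crossOut s t q (k 1) true (i 1) (u (.inr (0, true))) ∧
      u (.inr (2, false)) = crossOut s t q (k 2) false (i 2) (u (.inr (1, true))) ∧
      u (.inr (2, true)) = crossOut s t q (k 2) true (i 2) (u (.inr (1, true))) ∧
      o 0 = u (.inr (1, false)) ∧ o 1 = u (.inr (2, false)) ∧ o 2 = u (.inr (0, false)) := by
  refine (transmits_mk_iff 3 0 3 (fun
    | .inl 0 => left 1
    | .inl 1 => left 2
    | .inl 2 => left 0
    | .inr (.inr (0, false)) => strand 0
    | .inr (.inr (0, true)) => right 2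
    | .inr (.inr (1, false)) => strand 1
    | .inr (.inr (1, true)) => right 0
    | .inr (.inr (2, false)) => strand 2
    | .inr (.inr (2, true)) => right 1) (by decide)).trans ?_
  simp [Fin.forall_fin_succ, Sum.elim, and_assoc]

theorem cyclicTriangle'_transmits_iff {k : Fin 3 → Kind} {i o : Fin 3 → R}
    {u : Port (Fin 0) (Fin 3) → R} :
    (cyclicTriangle' k).Transmits s t q i o u ↔
      u (.inr (0, false)) = crossOut s t q (k 0) false (u (.inr (1, false))) (i 2) ∧
      u (.inr (0, true)) = crossOut s t q (k 0) true (u (.inr (1, false))) (i 2) ∧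
      u (.inr (1, false)) = crossOut s t q (k 1) false (u (.inr (2, false))) (i 0) ∧
      u (.inr (1, true)) = crossOut s t q (k 1) true (u (.inr (2, false))) (i 0) ∧
      u (.inr (2, false)) = crossOut s t q (k 2) false (u (.inr (0, false))) (i 1) ∧
      u (.inr (2, true)) = crossOut s t q (k 2) true (u (.inr (0, false))) (i 1) ∧
      o 0 = u (.inr (0, true)) ∧ o 1 = u (.inr (1, true)) ∧ o 2 = u (.inr (2, true)) := by
  refine (transmits_mk_iff 3 0 3 (fun
    | .inl 0 => right 0
    | .inl 1 => right 1
    | .inl 2 => right 2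
    | .inr (.inr (0, false)) => left 1
    | .inr (.inr (0, true)) => strand 2
    | .inr (.inr (1, false)) => left 2
    | .inr (.inr (1, true)) => strand 0
    | .inr (.inr (2, false)) => left 0
    | .inr (.inr (2, true)) => strand 1) (by decide)).trans ?_
  simp [Fin.forall_fin_succ, Sum.elim, and_assoc]

end
end Tangle
-- Uniqueness of the inner colours
namespace Tangle

section
variable {R : Type*} [CommRing R]

/-- If all entrances have the colour zero, then so have all edges. -/
def IsDetermined (s t q : Rˣ) {m : ℕ} (T : Tangle m) : Prop :=
  ∀ o u, T.Transmits s t q 0 o u → u = 0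

/-- The strands of the tangle arrive with the colours with which they enter. -/
def IsTransparent (s t q : Rˣ) {m : ℕ} (T : Tangle m) : Prop :=
  ∀ i o, (∃ u, T.Transmits s t q i o u) ↔ i = o

theorem eq_zero_of_forall {n : ℕ} {u : Port (Fin 0) (Fin n) → R}
    (h : ∀ c, u (.inr (c, false)) = 0 ∧ u (.inr (c, true)) = 0) : u = 0 := by
  refine funext ?_
  rintro (z | ⟨c, _ | _⟩)
  exacts [z.elim0, (h c).1, (h c).2]

/-- The colouring of the outgoing ends of crossings `k` with incoming colours `x` and `y`. -/
def crossColours (s t q : Rˣ) {n : ℕ} (k : Fin n → Kind) (x y : Fin n → R) :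
    Port (Fin 0) (Fin n) → R :=
  Sum.elim Fin.elim0 fun z => crossOut s t q (k z.1) z.2 (x z.1) (y z.1)

theorem crossColours_apply (s t q : Rˣ) {n : ℕ} (k : Fin n → Kind) (x y : Fin n → R) (c : Fin n)
    (b : Bool) : crossColours s t q k x y (.inr (c, b)) = crossOut s t q (k c) b (x c) (y c) :=
  rfl

/-- The colour of the left incoming end of a crossing, in terms of the colours `y` and `r` of
the two right ends. -/
def crossLeft (s t q : Rˣ) : Kind → R → R → R
  | .pos, _, r => ↑s⁻¹ * r
  | .neg, y, r => t * r - (t - ↑s⁻¹) * y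
  | .virt, _, r => ↑q⁻¹ * r

/-- The colour of the right incoming end of a crossing, in terms of the colours `x` and `l` of
the two left ends. -/
def crossRight (s t q : Rˣ) : Kind → R → R → R
  | .pos, x, l => ↑t⁻¹ * l - (↑t⁻¹ - s) * x
  | .neg, _, l => s * l
  | .virt, _, l => q * l

variable (s t q : Rˣ)

theorem point_isDetermined : point.IsDetermined s t q := by
  intro o u h
  have := point_transmits_iff.1 h
  refine funext fun (z : Port (Fin 1) (Fin 0)) => ?_
  rcases z with z | ⟨z, _⟩
  · rw [Subsingleton.elim z 0]; exact this.1
  · exact z.elim0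

theorem point_isTransparent : point.IsTransparent s t q := by
  intro i o
  rw [funext_iff, Fin.forall_fin_one]
  constructor
  · rintro ⟨u, h⟩
    have := point_transmits_iff.1 h
    exact this.1.symm.trans this.2.symm
  · intro h
    exact ⟨fun _ => i 0, point_transmits_iff.2 ⟨rfl, h.symm⟩⟩

theorem kinkRight_isDetermined (k : Kind) : (kinkRight k).IsDetermined s t q := by
  intro o (u : Port (Fin 0) (Fin 1) → R) h
  have := kinkRight_transmits_iff.1 h
  refine eq_zero_of_forall (Fin.forall_fin_one.2 ?_)
  have hs := s.mul_inv
  have ht := t.mul_inv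
  have hq := q.mul_inv
  cases k <;> simp only [crossOut, Pi.zero_apply] at this ⊢ <;> grind

theorem kinkLeft_isDetermined (k : Kind) : (kinkLeft k).IsDetermined s t q := by
  intro o (u : Port (Fin 0) (Fin 1) → R) h
  have := kinkLeft_transmits_iff.1 h
  refine eq_zero_of_forall (Fin.forall_fin_one.2 ?_)
  have hs := s.mul_inv
  have ht := t.mul_inv
  have hq := q.mul_inv
  cases k <;> simp only [crossOut, Pi.zero_apply] at this ⊢ <;> grind

theorem bigonParallel_isDetermined (k : Kind) : (bigonParallel k).IsDetermined s t q := by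
  intro o (u : Port (Fin 0) (Fin 2) → R) h
  have := bigonParallel_transmits_iff.1 h
  refine eq_zero_of_forall (Fin.forall_fin_two.2 ?_)
  cases k <;> simp only [crossOut, Pi.zero_apply, Kind.opp] at this ⊢ <;> grind

/-- The inner edges depend on each other circularly. One of the two crossings is positive or
virtual, and there the right outgoing colour depends only on the left incoming one, which is zero;
this breaks the circle. -/
theorem bigonRight_isDetermined (k : Kind) : (bigonRight k).IsDetermined s t q := by
  intro o (u : Port (Fin 0) (Fin 2) → R) h
  have := bigonRight_transmits_iff.1 h
  refine eq_zero_of_forall (Fin.forall_fin_two.2 ?_)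
  cases k <;> simp only [crossOut, Pi.zero_apply, Kind.opp] at this ⊢ <;> grind

theorem bigonLeft_isDetermined (k : Kind) : (bigonLeft k).IsDetermined s t q := by
  intro o (u : Port (Fin 0) (Fin 2) → R) h
  have := bigonLeft_transmits_iff.1 h
  refine eq_zero_of_forall (Fin.forall_fin_two.2 ?_)
  cases k <;> simp only [crossOut, Pi.zero_apply, Kind.opp] at this ⊢ <;> grind

theorem crossOut_zero (k : Kind) (b : Bool) : crossOut s t q k b 0 0 = 0 := by
  cases k <;> cases b <;> simp [crossOut]

theorem braidTriangle_isDetermined (k : Fin 3 → Kind) : (braidTriangle k).IsDetermined s t q := by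
  intro o (u : Port (Fin 0) (Fin 3) → R) h
  have := braidTriangle_transmits_iff.1 h
  refine eq_zero_of_forall ?_
  simp only [Fin.forall_fin_succ, IsEmpty.forall_iff, Fin.succ_zero_eq_one, Fin.succ_one_eq_two]
  simp_all [crossOut_zero]

theorem braidTriangle'_isDetermined (k : Fin 3 → Kind) :
    (braidTriangle' k).IsDetermined s t q := by
  intro o (u : Port (Fin 0) (Fin 3) → R) h
  have := braidTriangle'_transmits_iff.1 h
  refine eq_zero_of_forall ?_
  simp only [Fin.forall_fin_succ, IsEmpty.forall_iff, Fin.succ_zero_eq_one, Fin.succ_one_eq_two]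
  simp_all [crossOut_zero]

theorem exists_eq_of_cyclicAllowed {k : Fin 3 → Kind} (hk : CyclicAllowed k) :
    ∃ a b c, k = ![a, b, c] ∧ (a, b, c) ∈ ([(.pos, .pos, .neg), (.pos, .neg, .pos),
      (.pos, .neg, .neg), (.neg, .pos, .pos), (.neg, .pos, .neg), (.neg, .neg, .pos),
      (.virt, .virt, .virt), (.virt, .virt, .pos), (.virt, .virt, .neg), (.virt, .pos, .virt),
      (.virt, .neg, .virt), (.pos, .virt, .virt), (.neg, .virt, .virt)] :
      List (Kind × Kind × Kind)) := by
  refine ⟨k 0, k 1, k 2, by ext i; fin_cases i <;> rfl, ?_⟩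
  have h (k₁ : Kind) : k = ![k₁, k₁, k₁] ↔ k 0 = k₁ ∧ k 1 = k₁ ∧ k 2 = k₁ := by
    simp [funext_iff, Fin.forall_fin_succ]
  simp only [CyclicAllowed, Ne, h, Fin.forall_fin_succ, Fin.exists_fin_succ, Fin.succ_zero_eq_one,
    Fin.succ_one_eq_two] at hk
  revert hk
  rcases k 0 <;> rcases k 1 <;> rcases k 2 <;> simp

theorem exists_eq_of_braidAllowed {k : Fin 3 → Kind} (hk : BraidAllowed k) :
    ∃ a b c, k = ![a, b, c] ∧ (a, b, c) ∈ ([(.pos, .pos, .pos), (.pos, .pos, .neg),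
      (.pos, .neg, .neg), (.neg, .pos, .pos), (.neg, .neg, .neg), (.neg, .neg, .pos),
      (.virt, .virt, .virt), (.virt, .virt, .pos), (.virt, .virt, .neg), (.virt, .pos, .virt),
      (.virt, .neg, .virt), (.pos, .virt, .virt), (.neg, .virt, .virt)] :
      List (Kind × Kind × Kind)) := by
  refine ⟨k 0, k 1, k 2, by ext i; fin_cases i <;> rfl, ?_⟩
  have h (k₁ k₂ k₃ : Kind) : k = ![k₁, k₂, k₃] ↔ k 0 = k₁ ∧ k 1 = k₂ ∧ k 2 = k₃ := by
    simp [funext_iff, Fin.forall_fin_succ]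
  simp only [BraidAllowed, Ne, h, Fin.forall_fin_succ, Fin.exists_fin_succ, Fin.succ_zero_eq_one,
    Fin.succ_one_eq_two] at hk
  revert hk
  rcases k 0 <;> rcases k 1 <;> rcases k 2 <;> simp

/-- The inner edges run around the triangle through right ends. A crossing that is not negative
stops the circular dependence, because its right output ignores the right input; three negative
crossings are excluded by `hk`. For the mirrored triangle, the left outputs and three positive
crossings play these roles. -/
theorem cyclicTriangle_isDetermined {k : Fin 3 → Kind} (hk : CyclicAllowed k) :
    (cyclicTriangle k).IsDetermined s t q := by
  intro o (u : Port (Fin 0) (Fin 3) → R) h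
  have := cyclicTriangle_transmits_iff.1 h
  refine eq_zero_of_forall ?_
  simp only [Fin.forall_fin_succ, IsEmpty.forall_iff, Fin.succ_zero_eq_one, Fin.succ_one_eq_two]
  obtain ⟨a, b, c, rfl, h3⟩ := exists_eq_of_cyclicAllowed hk
  have hs := s.mul_inv
  have ht := t.mul_inv
  simp only [Matrix.cons_val] at this
  cases a <;> cases b <;> cases c <;>
    first
    | exact absurd h3 (by decide)
    | (simp only [crossOut, Pi.zero_apply] at this ⊢; grind)

theorem cyclicTriangle'_isDetermined {k : Fin 3 → Kind} (hk : CyclicAllowed k) :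
    (cyclicTriangle' k).IsDetermined s t q := by
  intro o (u : Port (Fin 0) (Fin 3) → R) h
  have := cyclicTriangle'_transmits_iff.1 h
  refine eq_zero_of_forall ?_
  simp only [Fin.forall_fin_succ, IsEmpty.forall_iff, Fin.succ_zero_eq_one, Fin.succ_one_eq_two]
  obtain ⟨a, b, c, rfl, h3⟩ := exists_eq_of_cyclicAllowed hk
  have hs := s.mul_inv
  have ht := t.mul_inv
  simp only [Matrix.cons_val] at this
  cases a <;> cases b <;> cases c <;>
    first
    | exact absurd h3 (by decide)
    | (simp only [crossOut, Pi.zero_apply] at this ⊢; grind)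

end
end Tangle
-- Invariance of the crossing rules under the local moves
namespace Tangle

section
variable {R : Type*} [CommRing R] (s t q : Rˣ)

theorem kinkRight_isTransparent (k : Kind) : (kinkRight k).IsTransparent s t q := by
  intro i o
  rw [funext_iff, Fin.forall_fin_one]
  have hs := s.mul_inv
  have ht := t.mul_inv
  have hq := q.mul_inv
  constructor
  · rintro ⟨u, h⟩
    have := kinkRight_transmits_iff.1 h
    cases k <;> simp only [crossOut] at this ⊢ <;> grind
  · intro h
    -- Both left ends carry the colour of the strand, so solving the crossing for its right incoming
    -- end gives the colour of the loop.
    refine ⟨_, (kinkRight_transmits_iff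
      (u := crossColours s t q ![k] i ![crossRight s t q k (i 0) (i 0)])).2 ?_⟩
    simp only [crossColours_apply, Matrix.cons_val_zero]
    cases k <;> simp only [crossOut, crossRight] <;> grind

theorem kinkLeft_isTransparent (k : Kind) : (kinkLeft k).IsTransparent s t q := by
  intro i o
  rw [funext_iff, Fin.forall_fin_one]
  have hs := s.mul_inv
  have ht := t.mul_inv
  have hq := q.mul_inv
  constructor
  · rintro ⟨u, h⟩
    have := kinkLeft_transmits_iff.1 h
    cases k <;> simp only [crossOut] at this ⊢ <;> grind
  · intro h
    refine ⟨_, (kinkLeft_transmits_iff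
      (u := crossColours s t q ![k] ![crossLeft s t q k (i 0) (i 0)] i)).2 ?_⟩
    simp only [crossColours_apply, Matrix.cons_val_zero]
    cases k <;> simp only [crossOut, crossLeft] <;> grind

/-- The rules of opposite crossings are inverse linear maps. -/
theorem bigonParallel_isTransparent (k : Kind) : (bigonParallel k).IsTransparent s t q := by
  intro i o
  rw [funext_iff, Fin.forall_fin_two]
  have hs := s.mul_inv
  have ht := t.mul_inv
  have hq := q.mul_inv
  constructor
  · rintro ⟨u, h⟩
    have := bigonParallel_transmits_iff.1 h
    cases k <;> simp only [crossOut, Kind.opp] at this ⊢ <;> grind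
  · intro h
    refine ⟨_, (bigonParallel_transmits_iff
      (u := crossColours s t q ![k, k.opp] ![i 0, crossOut s t q k false (i 0) (i 1)]
        ![i 1, crossOut s t q k true (i 0) (i 1)])).2 ?_⟩
    simp only [crossColours_apply, Matrix.cons_val_zero, Matrix.cons_val_one]
    cases k <;> simp only [crossOut, Kind.opp] <;> grind

theorem bigonRight_isTransparent (k : Kind) : (bigonRight k).IsTransparent s t q := by
  intro i o
  rw [funext_iff, Fin.forall_fin_two]
  have hs := s.mul_inv
  have ht := t.mul_inv
  have hq := q.mul_inv
  constructor
  · rintro ⟨u, h⟩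
    have := bigonRight_transmits_iff.1 h
    cases k <;> simp only [crossOut, Kind.opp] at this ⊢ <;> grind
  · intro h
    -- Transparency prescribes both left colours at each crossing: strand `0` leaves at crossing `1`
    -- and strand `1` at crossing `0`. The inner colours follow by solving for the right incoming
    -- ends.
    refine ⟨_, (bigonRight_transmits_iff
      (u := crossColours s t q ![k, k.opp] i ![crossRight s t q k (i 0) (i 1),
      crossRight s t q k.opp (i 1) (i 0)])).2 ?_⟩
    simp only [crossColours_apply, Matrix.cons_val_zero, Matrix.cons_val_one]
    cases k <;> simp only [crossOut, crossRight, Kind.opp] <;> grind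

theorem bigonLeft_isTransparent (k : Kind) : (bigonLeft k).IsTransparent s t q := by
  intro i o
  rw [funext_iff, Fin.forall_fin_two]
  have hs := s.mul_inv
  have ht := t.mul_inv
  have hq := q.mul_inv
  constructor
  · rintro ⟨u, h⟩
    have := bigonLeft_transmits_iff.1 h
    cases k <;> simp only [crossOut, Kind.opp] at this ⊢ <;> grind
  · intro h
    refine ⟨_, (bigonLeft_transmits_iff
      (u := crossColours s t q ![k, k.opp] ![crossLeft s t q k (i 0) (i 1),
      crossLeft s t q k.opp (i 1) (i 0)] i)).2 ?_⟩
    simp only [crossColours_apply, Matrix.cons_val_zero, Matrix.cons_val_one]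
    cases k <;> simp only [crossOut, crossLeft, Kind.opp] <;> grind

/-- This is the Yang–Baxter equation for the linear crossing rules. The witnesses propagate the
entrance colours upwards, crossing by crossing. -/
theorem braidTriangle_equiv {k : Fin 3 → Kind} (hk : BraidAllowed k) (i o : Fin 3 → R) :
    (∃ u, (braidTriangle k).Transmits s t q i o u) ↔
      ∃ u, (braidTriangle' k).Transmits s t q i o u := by
  obtain ⟨a, b, c, rfl, h3⟩ := exists_eq_of_braidAllowed hk
  constructor
  · rintro ⟨u, h⟩
    have := braidTriangle_transmits_iff.1 h
    refine ⟨_, (braidTriangle'_transmits_iff (u := crossColours s t q ![a, b, c]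
      ![crossOut s t q b true (i 0) (crossOut s t q c false (i 1) (i 2)), i 0, i 1]
      ![crossOut s t q c true (i 1) (i 2), crossOut s t q c false (i 1) (i 2), i 2])).2 ?_⟩
    clear h
    have hs := s.mul_inv
    have ht := t.mul_inv
    have hq := q.mul_inv
    simp only [crossColours_apply, Matrix.cons_val] at this ⊢
    cases a <;> cases b <;> cases c <;>
      first
      | exact absurd h3 (by decide)
      | (simp only [crossOut] at this ⊢; grind)
  · rintro ⟨u, h⟩
    have := braidTriangle'_transmits_iff.1 h
    refine ⟨_, (braidTriangle_transmits_iff (u := crossColours s t q ![a, b, c]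
      ![i 0, crossOut s t q a true (i 0) (i 1), crossOut s t q a false (i 0) (i 1)]
      ![i 1, i 2, crossOut s t q b false (crossOut s t q a true (i 0) (i 1)) (i 2)])).2 ?_⟩
    clear h
    have hs := s.mul_inv
    have ht := t.mul_inv
    have hq := q.mul_inv
    simp only [crossColours_apply, Matrix.cons_val] at this ⊢
    cases a <;> cases b <;> cases c <;>
      first
      | exact absurd h3 (by decide)
      | (simp only [crossOut] at this ⊢; grind)

/-- The colours cannot be propagated from the entrances alone. Each crossing has two outer ends on
one side, though, and their colours determine the inner incoming end through `crossLeft` or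
`crossRight`. -/
theorem cyclicTriangle_equiv {k : Fin 3 → Kind} (hk : CyclicAllowed k) (i o : Fin 3 → R) :
    (∃ u, (cyclicTriangle k).Transmits s t q i o u) ↔
      ∃ u, (cyclicTriangle' k).Transmits s t q i o u := by
  obtain ⟨a, b, c, rfl, h3⟩ := exists_eq_of_cyclicAllowed hk
  constructor
  · rintro ⟨u, h⟩
    have := cyclicTriangle_transmits_iff.1 h
    refine ⟨_, (cyclicTriangle'_transmits_iff (u := crossColours s t q ![a, b, c]
      ![crossLeft s t q a (i 2) (o 0), crossLeft s t q b (i 0) (o 1),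
        crossLeft s t q c (i 1) (o 2)] ![i 2, i 0, i 1])).2 ?_⟩
    clear h
    have hs := s.mul_inv
    have ht := t.mul_inv
    have hq := q.mul_inv
    simp only [crossColours_apply, Matrix.cons_val] at this ⊢
    cases a <;> cases b <;> cases c <;>
      first
      | exact absurd h3 (by decide)
      | (simp only [crossOut, crossLeft] at this ⊢; grind)
  · rintro ⟨u, h⟩
    have := cyclicTriangle'_transmits_iff.1 h
    refine ⟨_, (cyclicTriangle_transmits_iff (u := crossColours s t q ![a, b, c]
      ![i 0, i 1, i 2] ![crossRight s t q a (i 0) (o 2), crossRight s t q b (i 1) (o 0),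
        crossRight s t q c (i 2) (o 1)])).2 ?_⟩
    clear h
    have hs := s.mul_inv
    have ht := t.mul_inv
    have hq := q.mul_inv
    simp only [crossColours_apply, Matrix.cons_val] at this ⊢
    cases a <;> cases b <;> cases c <;>
      first
      | exact absurd h3 (by decide)
      | (simp only [crossOut, crossRight] at this ⊢; grind)

end
end Tangle

/-! ### The colouring space and the insertion of tangles -/

/-- `vertexOut` as a linear map. -/
def vertexOutLinear {R : Type*} [CommRing R] (s t q : Rˣ) {P X : Type} (k : X → Kind) :
    (Port P X → R) →ₗ[R] (Port P X → R) where
  toFun := vertexOut s t q k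
  map_add' c d := by
    funext p
    rcases p with v | ⟨x, b⟩
    · rfl
    · simp only [vertexOut, Pi.add_apply]
      cases k x <;> cases b <;> simp only [crossOut] <;> ring
  map_smul' r c := by
    funext p
    rcases p with v | ⟨x, b⟩
    · rfl
    · simp only [vertexOut, Pi.smul_apply, smul_eq_mul, RingHom.id_apply]
      cases k x <;> cases b <;> simp only [crossOut] <;> ring

namespace PreDiagram

section
variable {R : Type*} [CommRing R] (s t q : Rˣ)

/-- The defect of the vertex equations of a colouring of the arcs. -/
def colourMap (D : PreDiagram) : (D.Arc → R) →ₗ[R] (D.Arc → R) :=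
  vertexOutLinear s t q D.kind ∘ₗ LinearMap.funLeft R R D.next.symm - LinearMap.id

/-- The colourings of the arcs that satisfy the equations of all vertices. -/
def colourings (D : PreDiagram) : Submodule R (D.Arc → R) :=
  LinearMap.ker (D.colourMap s t q)

variable {s t q}

theorem mem_colourings_iff {D : PreDiagram} {c : D.Arc → R} :
    c ∈ D.colourings s t q ↔
      ∀ p, c p = vertexOut s t q D.kind (fun p' => c (D.next.symm p')) p := by
  rw [colourings, LinearMap.mem_ker, colourMap, LinearMap.sub_apply, sub_eq_zero, eq_comm,
    funext_iff]
  rfl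

theorem insertEmbedding_inr_notMem_range (D : PreDiagram) {m : ℕ} (a : Fin m ↪ D.Arc) (T : Tangle m)
    (p : Port (Fin T.np) (Fin T.nx)) :
    insertEmbedding D a T (.inr p) ∉ Set.range (oldEmbedding D T) := by
  rintro ⟨z, hz⟩
  rcases z with z | ⟨z, _⟩ <;> rcases p with p | ⟨p, _⟩ <;> cases hz

theorem insert_next_symm_new (D : PreDiagram) {m : ℕ} (a : Fin m ↪ D.Arc) (T : Tangle m)
    (p : Port (Fin T.np) (Fin T.nx)) :
    (D.insert a T).next.symm (insertEmbedding D a T (.inr p)) =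
      insertEmbedding D a T (T.conn.symm (.inr p)) := by
  refine (Equiv.symm_apply_eq (D.next.viaEmbedding (oldEmbedding D T) *
    T.conn.viaEmbedding (insertEmbedding D a T))).2 ?_
  rw [Equiv.Perm.mul_apply, Equiv.Perm.viaEmbedding_apply, Equiv.apply_symm_apply,
    Equiv.Perm.viaEmbedding_apply_of_notMem _ _ _ (D.insertEmbedding_inr_notMem_range a T p)]

/-- An old incoming end keeps its edge unless this edge was cut; a cut edge is replaced by the one
that leaves the tangle at the corresponding exit. -/
theorem insert_next_symm_old (D : PreDiagram) {m : ℕ} (a : Fin m ↪ D.Arc) (T : Tangle m)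
    (p : Port D.Pt D.Xing) :
    (D.insert a T).next.symm (oldEmbedding D T p) =
      Function.extend a (fun j => insertEmbedding D a T (T.conn.symm (.inl j))) (oldEmbedding D T)
        (D.next.symm p) := by
  refine (Equiv.symm_apply_eq (D.next.viaEmbedding (oldEmbedding D T) *
    T.conn.viaEmbedding (insertEmbedding D a T))).2 ?_
  obtain ⟨p, rfl⟩ := D.next.surjective p
  rw [Equiv.symm_apply_apply, Equiv.Perm.mul_apply]
  by_cases h : ∃ j, a j = p
  · obtain ⟨j, rfl⟩ := h
    rw [a.injective.extend_apply, Equiv.Perm.viaEmbedding_apply, Equiv.apply_symm_apply]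
    exact (Equiv.Perm.viaEmbedding_apply _ _ _).symm
  · rw [Function.extend_apply' _ _ _ h,
      Equiv.Perm.viaEmbedding_apply_of_notMem T.conn _ (oldEmbedding D T p),
      Equiv.Perm.viaEmbedding_apply]
    rintro ⟨j | z, hz⟩
    · exact h ⟨j, (oldEmbedding D T).injective hz⟩
    · exact D.insertEmbedding_inr_notMem_range a T z ⟨p, hz.symm⟩

/-- A colouring after the insertion of a tangle is a colouring of the tangle and of the rest. -/
theorem mem_colourings_insert_iff (D : PreDiagram) {m : ℕ} (a : Fin m ↪ D.Arc) (T : Tangle m)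
    (c : (D.insert a T).Arc → R) :
    c ∈ (D.insert a T).colourings s t q ↔
      ∃ o, T.Transmits s t q (fun j => c (oldEmbedding D T (a j))) o
          (fun p => c (insertEmbedding D a T (.inr p))) ∧
        ∀ p, c (oldEmbedding D T p) = vertexOut s t q D.kind (fun p' =>
          Function.extend a o (fun p => c (oldEmbedding D T p)) (D.next.symm p')) p := by
  have hc (z) : Sum.elim (fun j => c (oldEmbedding D T (a j)))
      (fun p => c (insertEmbedding D a T (.inr p))) z = c (insertEmbedding D a T z) := by
    rcases z with j | z <;> rfl
  have hext (o : Fin m → R) (ho : ∀ j, o j = c (insertEmbedding D a T (T.conn.symm (.inl j)))) (p) :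
      c ((D.insert a T).next.symm (oldEmbedding D T p)) =
        Function.extend a o (fun p => c (oldEmbedding D T p)) (D.next.symm p) := by
    rw [insert_next_symm_old]
    by_cases h : ∃ j, a j = D.next.symm p
    · obtain ⟨j, hj⟩ := h
      rw [← hj, a.injective.extend_apply, a.injective.extend_apply, ho]
    · rw [Function.extend_apply' _ _ _ h, Function.extend_apply' _ _ _ h]
  have hold (p : Port D.Pt D.Xing) :
      vertexOut s t q (D.insert a T).kind (fun p' => c ((D.insert a T).next.symm p'))
        (oldEmbedding D T p) = vertexOut s t q D.kind
          (fun p' => c ((D.insert a T).next.symm (oldEmbedding D T p'))) p := by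
    rcases p with p | ⟨p, _⟩ <;> rfl
  have hnew (p : Port (Fin T.np) (Fin T.nx)) :
      vertexOut s t q (D.insert a T).kind (fun p' => c ((D.insert a T).next.symm p'))
        (insertEmbedding D a T (.inr p)) = vertexOut s t q T.kind
          (fun p' => c ((D.insert a T).next.symm (insertEmbedding D a T (.inr p')))) p := by
    rcases p with p | ⟨p, _⟩ <;> rfl
  simp only [insert_next_symm_new] at hnew
  rw [mem_colourings_iff]
  simp only [Tangle.Transmits, hc]
  constructor
  · intro h
    refine ⟨_, ⟨fun p => (h _).trans (hnew p), fun j => rfl⟩, fun p => (h _).trans ?_⟩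
    rw [hold]
    simp only [hext _ fun _ => rfl]
  · rintro ⟨o, ⟨h1, h2⟩, h3⟩
    have hold' (p) := (h3 p).trans ((congrArg (vertexOut s t q D.kind · p)
      (funext fun p' => (hext o h2 p').symm)).trans (hold p).symm)
    have hnew' (p) := (h1 p).trans (hnew p).symm
    rintro ((v | v) | ⟨x | x, b⟩)
    exacts [hold' (.inl v), hnew' (.inl v), hold' (.inr (x, b)), hnew' (.inr (x, b))]

/-- The restriction to the arcs that were there before a tangle has been inserted. -/
def restrictOld (D : PreDiagram) {m : ℕ} (a : Fin m ↪ D.Arc) (T : Tangle m) :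
    ((D.insert a T).Arc → R) →ₗ[R] (D.Arc → R) :=
  LinearMap.funLeft R R (oldEmbedding D T)

/-- Seen from the old arcs, a tangle matters only through the relation between its entrance and exit
colours. Hence tangles with the same relation can be exchanged. -/
theorem mem_map_restrictOld_iff (D : PreDiagram) {m : ℕ} (a : Fin m ↪ D.Arc) (T : Tangle m)
    (c : D.Arc → R) :
    c ∈ ((D.insert a T).colourings s t q).map (restrictOld D a T) ↔
      ∃ o, (∃ u, T.Transmits s t q (fun j => c (a j)) o u) ∧
        ∀ p, c p = vertexOut s t q D.kind (fun p' =>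
          Function.extend a o c (D.next.symm p')) p := by
  rw [Submodule.mem_map]
  constructor
  · rintro ⟨c, hc, rfl⟩
    obtain ⟨o, h1, h2⟩ := (D.mem_colourings_insert_iff a T c).1 hc
    exact ⟨o, ⟨_, h1⟩, h2⟩
  · rintro ⟨o, ⟨u, h1⟩, h2⟩
    let c' : (D.insert a T).Arc → R
      | .inl (.inl v) => c (.inl v)
      | .inl (.inr v) => u (.inl v)
      | .inr (.inl x, b) => c (.inr (x, b))
      | .inr (.inr x, b) => u (.inr (x, b))
    have hold (p) : c' (oldEmbedding D T p) = c p := by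
      rcases p with p | ⟨p, _⟩ <;> rfl
    have hnew (p) : c' (insertEmbedding D a T (.inr p)) = u p := by
      rcases p with p | ⟨p, _⟩ <;> rfl
    refine ⟨c', (D.mem_colourings_insert_iff a T c').2 ⟨o, ?_⟩, funext hold⟩
    simp only [hold, hnew]
    exact ⟨h1, h2⟩

end

/-! ### Invariance of the dimension over a field -/

section
variable {F : Type*} [Field F] {s t q : Fˣ}

/-- For a determined tangle, a colouring that vanishes on the old arcs vanishes inside too, so
restriction is injective. Dimensions can then be compared inside the fixed space of functions on the
old arcs. -/
theorem finrank_map_restrictOld (D : PreDiagram) {m : ℕ} (a : Fin m ↪ D.Arc) {T : Tangle m}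
    (hT : T.IsDetermined s t q) :
    Module.finrank F (((D.insert a T).colourings s t q).map (restrictOld D a T)) =
      Module.finrank F ((D.insert a T).colourings s t q) := by
  rw [← LinearMap.range_domRestrict]
  refine LinearMap.finrank_range_of_inj ((injective_iff_map_eq_zero _).2 fun c hc => ?_)
  obtain ⟨c, hcm⟩ := c
  have hold (p) : c (oldEmbedding D T p) = 0 := congrFun hc p
  obtain ⟨o, h1, -⟩ := (D.mem_colourings_insert_iff a T c).1 hcm
  simp only [hold] at h1
  have hnew (p) := congrFun (hT o _ h1) p
  refine Subtype.ext (funext ?_)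
  rintro ((v | v) | ⟨x | x, b⟩)
  exacts [hold (.inl v), hnew (.inl v), hold (.inr (x, b)), hnew (.inr (x, b))]

theorem finrank_colourings_insert_congr (D : PreDiagram) {m : ℕ} (a : Fin m ↪ D.Arc)
    {T T' : Tangle m} (hT : T.IsDetermined s t q) (hT' : T'.IsDetermined s t q)
    (h : ∀ i o, (∃ u, T.Transmits s t q i o u) ↔ ∃ u, T'.Transmits s t q i o u) :
    Module.finrank F ((D.insert a T).colourings s t q) =
      Module.finrank F ((D.insert a T').colourings s t q) := by
  rw [← D.finrank_map_restrictOld a hT, ← D.finrank_map_restrictOld a hT']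
  refine congrArg (fun S : Submodule F (D.Arc → F) => Module.finrank F S)
    (Submodule.ext fun c => ?_)
  simp only [mem_map_restrictOld_iff, h]

theorem finrank_colourings_insert (D : PreDiagram) {m : ℕ} (a : Fin m ↪ D.Arc)
    {T : Tangle m} (hT : T.IsDetermined s t q) (h : T.IsTransparent s t q) :
    Module.finrank F ((D.insert a T).colourings s t q) =
      Module.finrank F (D.colourings s t q) := by
  rw [← D.finrank_map_restrictOld a hT]
  refine congrArg (fun S : Submodule F (D.Arc → F) => Module.finrank F S)
    (Submodule.ext fun c => ?_)
  rw [mem_map_restrictOld_iff, mem_colourings_iff]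
  -- Transparency forces the exit colours to equal the entrance colours, so the cut edges act as if
  -- they were uncut.
  have hext : Function.extend a (fun j => c (a j)) c = c := by
    funext p
    by_cases h : ∃ j, a j = p
    · obtain ⟨j, rfl⟩ := h
      rw [a.injective.extend_apply]
    · rw [Function.extend_apply' _ _ _ h]
  simp only [h _ _, exists_eq_left', hext]

theorem finrank_colourings_eq_of_equiv {D E : PreDiagram} (e : D.Pt ≃ E.Pt) (f : D.Xing ≃ E.Xing)
    (hkind : ∀ x, E.kind (f x) = D.kind x)
    (hnext : ∀ p, E.next (Sum.map e (Prod.map f id) p) = Sum.map e (Prod.map f id) (D.next p)) :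
    Module.finrank F (D.colourings s t q) = Module.finrank F (E.colourings s t q) := by
  let g : D.Arc ≃ E.Arc := Equiv.sumCongr e (Equiv.prodCongr f (Equiv.refl _))
  have hg (p) : E.next.symm (g p) = g (D.next.symm p) := by
    rw [Equiv.symm_apply_eq]
    obtain ⟨p, rfl⟩ := D.next.surjective p
    rw [Equiv.symm_apply_apply]
    exact (hnext p).symm
  have h : D.colourings s t q =
      (E.colourings s t q).map (LinearEquiv.funCongrLeft F F g).toLinearMap := by
    ext c
    obtain ⟨c, rfl⟩ := (LinearEquiv.funCongrLeft F F g).surjective c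
    rw [Submodule.mem_map_equiv, LinearEquiv.symm_apply_apply, mem_colourings_iff,
      mem_colourings_iff, ← g.forall_congr_right]
    refine forall_congr' fun p => ?_
    have : vertexOut s t q E.kind (fun p' => c (E.next.symm p')) (g p) =
        vertexOut s t q D.kind (fun p' => c (E.next.symm (g p'))) p := by
      rcases p with v | ⟨x, b⟩
      · rfl
      · change crossOut s t q (E.kind (f x)) _ _ _ = _
        rw [hkind]
        rfl
    rw [this]
    simp only [hg]
    rfl
  rw [h]
  exact LinearEquiv.finrank_map_eq _ _

/-- The dimension of the space of colourings does not change under generalized Reidemeister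
moves. -/
theorem _root_.VirtualLinks.Move.finrank_colourings_eq {D E : PreDiagram} (h : Move D E) :
    Module.finrank F (D.colourings s t q) = Module.finrank F (E.colourings s t q) := by
  cases h with
  | rename D E e f hkind hnext => exact finrank_colourings_eq_of_equiv e f hkind hnext
  | point D a =>
    exact (D.finrank_colourings_insert a (Tangle.point_isDetermined s t q)
      (Tangle.point_isTransparent s t q)).symm
  | kinkRight D a k =>
    exact (D.finrank_colourings_insert a (Tangle.kinkRight_isDetermined s t q k)
      (Tangle.kinkRight_isTransparent s t q k)).symm
  | kinkLeft D a k =>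
    exact (D.finrank_colourings_insert a (Tangle.kinkLeft_isDetermined s t q k)
      (Tangle.kinkLeft_isTransparent s t q k)).symm
  | bigonParallel D a k =>
    exact (D.finrank_colourings_insert a (Tangle.bigonParallel_isDetermined s t q k)
      (Tangle.bigonParallel_isTransparent s t q k)).symm
  | bigonRight D a k =>
    exact (D.finrank_colourings_insert a (Tangle.bigonRight_isDetermined s t q k)
      (Tangle.bigonRight_isTransparent s t q k)).symm
  | bigonLeft D a k =>
    exact (D.finrank_colourings_insert a (Tangle.bigonLeft_isDetermined s t q k)
      (Tangle.bigonLeft_isTransparent s t q k)).symm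
  | braidTriangle D a k hk =>
    exact D.finrank_colourings_insert_congr a (Tangle.braidTriangle_isDetermined s t q k)
      (Tangle.braidTriangle'_isDetermined s t q k) (Tangle.braidTriangle_equiv s t q hk)
  | cyclicTriangle D a k hk =>
    exact D.finrank_colourings_insert_congr a (Tangle.cyclicTriangle_isDetermined s t q hk)
      (Tangle.cyclicTriangle'_isDetermined s t q hk) (Tangle.cyclicTriangle_equiv s t q hk)

end
end PreDiagram

/-- The dimension of the space of colourings is an invariant of virtual links. -/
theorem Diagram.finrank_colourings_eq {F : Type*} [Field F] {s t q : Fˣ} {D E : Diagram}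
    (h : D.toLink = E.toLink) : Module.finrank F (D.toPreDiagram.colourings s t q) =
      Module.finrank F (E.toPreDiagram.colourings s t q) := by
  have h' := Quot.eqvGen_exact h
  clear h
  induction h' with
  | rel _ _ h => exact h.finrank_colourings_eq
  | refl => rfl
  | symm _ _ _ ih => exact ih.symm
  | trans _ _ _ _ _ ih₁ ih₂ => exact ih₁.trans ih₂

/-! ### Detecting a single component by colourings -/

namespace PreDiagram

/-- When all variables are 1, every kind of crossing passes the two colours on unchanged along the
strands. -/
theorem mem_colourings_one_iff {R : Type*} [CommRing R] {D : PreDiagram} {c : D.Arc → R} :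
    c ∈ D.colourings 1 1 1 ↔ ∀ p, c ((D.opposite * D.next) p) = c p := by
  have h (d : Port D.Pt D.Xing → R) (p) :
      vertexOut 1 1 1 D.kind d (D.opposite p) = d p := by
    rcases p with v | ⟨x, b⟩
    · rfl
    · change crossOut 1 1 1 (D.kind x) (!b) _ _ = _
      cases D.kind x <;> cases b <;> simp [crossOut]
  rw [mem_colourings_iff, ← (D.opposite * D.next).forall_congr_right]
  simp [h]

/-- Having one component is equivalent to the constants being the only colourings at
`s = t = q = 1`. -/
theorem hasOneComponent_iff (D : PreDiagram) :
    D.HasOneComponent ↔ Module.finrank ℚ (D.colourings (1 : ℚˣ) 1 1) ≤ 1 := by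
  have hone : (1 : D.Arc → ℚ) ∈ D.colourings (1 : ℚˣ) 1 1 :=
    mem_colourings_one_iff.2 fun _ => rfl
  rw [finrank_le_one_iff]
  constructor
  · intro h
    refine ⟨⟨1, hone⟩, fun c => ?_⟩
    obtain ⟨c, hc⟩ := c
    rw [mem_colourings_one_iff] at hc
    have hconst (p p') : c p = c p' := by
      obtain ⟨n, rfl⟩ := h p' p
      refine n.induction_on (by simp) (fun i hi => ?_) fun i hi => ?_
      · rw [add_comm, zpow_add, zpow_one, Equiv.Perm.mul_apply, hc, hi]
      · rw [← hc, ← Equiv.Perm.mul_apply, ← zpow_one_add, add_sub_cancel, hi]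
    by_cases hD : Nonempty D.Arc
    · obtain ⟨p⟩ := hD
      refine ⟨c p, Subtype.ext (funext fun p' => ?_)⟩
      simpa using hconst p p'
    · exact ⟨0, Subtype.ext (funext fun p => (hD ⟨p⟩).elim)⟩
  · rintro ⟨v, hv⟩ p p'
    classical
    obtain ⟨a, ha⟩ := hv ⟨1, hone⟩
    -- The indicator of the circuit through `p` is a colouring. Being proportional to a generator
    -- that is constant, it must be constant.
    have hind : (fun p' => if (D.opposite * D.next).SameCycle p p' then (1 : ℚ) else 0) ∈
        D.colourings (1 : ℚˣ) 1 1 := by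
      rw [mem_colourings_one_iff]
      intro p'
      simp only [Equiv.Perm.sameCycle_apply_right]
    obtain ⟨b, hb⟩ := hv ⟨_, hind⟩
    have ha' (p) : a * v.1 p = 1 := congrFun (congrArg Subtype.val ha) p
    have hb' (p') : b * v.1 p' = if (D.opposite * D.next).SameCycle p p' then (1 : ℚ) else 0 :=
      congrFun (congrArg Subtype.val hb) p'
    have h1 := hb' p
    rw [if_pos (Equiv.Perm.SameCycle.refl _ _)] at h1
    by_contra hne
    have h2 := hb' p'
    rw [if_neg hne] at h2
    have : v.1 p = v.1 p' := by
      have := (ha' p).trans (ha' p').symm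
      exact mul_left_cancel₀ (left_ne_zero_of_mul_eq_one (ha' p)) this
    rw [this, h2] at h1
    exact zero_ne_one h1

end PreDiagram

/-- All diagrams of a virtual knot have one component. -/
theorem Diagram.hasOneComponent_of_toLink_eq {D E : Diagram} (h : D.toLink = E.toLink)
    (hE : E.HasOneComponent) : D.HasOneComponent := by
  rw [PreDiagram.hasOneComponent_iff] at hE ⊢
  rwa [Diagram.finrank_colourings_eq h]

/-! ### Colourings by units on a single circuit -/

/-- On a single cycle, a weight with product one is a coboundary. -/
theorem exists_coboundary {α G : Type*} [Fintype α] [CommGroup G] (π : Equiv.Perm α)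
    (hπ : ∀ a b, π.SameCycle a b) (w : α → G) (hw : ∏ a, w a = 1) :
    ∃ c : α → G, ∀ a, c (π a) = w a * c a := by
  classical
  by_cases hα : Nonempty α
  swap
  · exact ⟨1, fun a => (hα ⟨a⟩).elim⟩
  obtain ⟨a₀⟩ := hα
  have hcyc : π.IsCycleOn (Finset.univ : Finset α) :=
    ⟨by simp [Set.bijOn_univ], fun a _ b _ => hπ a b⟩
  have hn := Finset.card_pos.2 ⟨a₀, Finset.mem_univ a₀⟩
  choose k hk hk' using fun a => hcyc.exists_pow_eq (Finset.mem_univ a₀) (Finset.mem_univ a)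
  -- The coboundary is the partial product along the cycle from `a₀`. A full turn gives the product
  -- of all weights, which is 1, so the value closes up at `a₀`.
  let f : ℕ → G := fun m => ∏ i ∈ Finset.range m, w ((π ^ i) a₀)
  have hcard : f (Finset.univ : Finset α).card = 1 := by
    rw [← hw]
    refine Finset.prod_bij (fun i _ => (π ^ i) a₀) (by simp) ?_ ?_ (by simp)
    · intro i hi j hj hij
      have := (hcyc.pow_apply_eq_pow_apply (Finset.mem_univ a₀)).1 hij
      exact this.eq_of_lt_of_lt (Finset.mem_range.1 hi) (Finset.mem_range.1 hj)
    · intro b _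
      exact ⟨k b, Finset.mem_range.2 (hk b), hk' b⟩
  refine ⟨fun a => f (k a), fun a => ?_⟩
  have hstep : f (k a + 1) = w a * f (k a) := by
    simp only [f, Finset.prod_range_succ, hk', mul_comm]
  change f (k (π a)) = _
  rw [← hstep]
  have hmod : k (π a) ≡ k a + 1 [MOD (Finset.univ : Finset α).card] := by
    rw [← hcyc.pow_apply_eq_pow_apply (Finset.mem_univ a₀), hk', pow_succ', Equiv.Perm.mul_apply,
      hk']
  rcases (Nat.succ_le_of_lt (hk a)).lt_or_eq with h | h
  · rw [hmod.eq_of_lt_of_lt (hk _) h]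
  · have h0 : k (π a) = 0 := by
      refine Nat.ModEq.eq_of_lt_of_lt (hmod.trans ?_) (hk _) hn
      rw [show k a + 1 = _ from h]
      simp [Nat.ModEq]
    rw [h0, show k a + 1 = _ from h, hcard]
    rfl

namespace PreDiagram

variable {R : Type*} [CommRing R]

/-- A diagram with one component has a colouring by units at `s = t⁻¹`. -/
theorem exists_unit_colouring (D : PreDiagram) (hD : D.HasOneComponent) (t q : Rˣ) :
    ∃ c : D.Arc → Rˣ, (fun p => (c p : R)) ∈ D.colourings t⁻¹ t q := by
  -- At `s = t⁻¹` the coefficient 1 - ts vanishes, and so does its counterpart at negative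
  -- crossings. The weight is the factor acquired at the vertex where `p` arrives; the two factors
  -- of a crossing are inverse to each other.
  let w : D.Arc → Rˣ := fun p => match D.next p with
    | .inl _ => 1
    | .inr (x, true) => if D.kind x = .virt then q⁻¹ else t
    | .inr (x, false) => if D.kind x = .virt then q else t⁻¹
  have hw : ∏ p, w p = 1 := by
    rw [← D.next.symm.prod_comp]
    simp only [w, Equiv.apply_symm_apply, Fintype.prod_sum_type, Fintype.prod_prod_type,
      Fintype.prod_bool, Finset.prod_const_one, one_mul]
    refine Finset.prod_eq_one fun x _ => ?_
    split_ifs <;> simp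
  obtain ⟨c, hc⟩ := exists_coboundary _ hD w hw
  refine ⟨c, mem_colourings_iff.2 ?_⟩
  rw [← (D.opposite * D.next).forall_congr_right]
  intro p
  rw [hc]
  obtain ⟨p, rfl⟩ := D.next.symm.surjective p
  simp only [w, Equiv.apply_symm_apply, Equiv.Perm.mul_apply]
  rcases p with v | ⟨x, b⟩
  · simp [vertexOut, opposite]
  · change _ = crossOut t⁻¹ t q (D.kind x) (!b) _ _
    cases h : D.kind x <;> cases b <;> simp [crossOut, h]

end PreDiagram
-- Planarity and Alexander numberings
namespace PreDiagram

variable (D : PreDiagram)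

/-- The faces of the surface on which a diagram is drawn. -/
abbrev Face : Type := Quotient (Equiv.Perm.SameCycle.setoid (D.rotation * D.edgeFlip))

/-- The connected components of the underlying graph. -/
abbrev Piece : Type :=
  MulAction.orbitRel.Quotient (Subgroup.closure {D.rotation, D.edgeFlip}) D.Dart

/-- The face on the side of a half-edge. -/
def face (d : D.Dart) : D.Face := Quotient.mk _ d

/-- The vertex to which an end belongs. -/
def vertex {P X : Type} : Port P X → P ⊕ X := Sum.map id Prod.fst

/-- As `edgeFlip` is an involution, the face permutation takes `edgeFlip d` to `rotation d`. -/
theorem face_edgeFlip (d : D.Dart) : D.face (D.edgeFlip d) = D.face (D.rotation d) := by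
  refine Quotient.sound (?_ : (D.rotation * D.edgeFlip).SameCycle _ _)
  have h : D.rotation d = (D.rotation * D.edgeFlip) (D.edgeFlip d) := by
    rw [Equiv.Perm.mul_apply]
    congr 1
    rcases d with p | p <;> simp [edgeFlip]
  rw [h, Equiv.Perm.sameCycle_apply_right]

/-- The functions on half-edges that are constant on the pieces. -/
def invariantFunctions : Submodule ℚ (D.Dart → ℚ) where
  carrier := {m | ∀ d, m (D.rotation d) = m d ∧ m (D.edgeFlip d) = m d}
  add_mem' hm hn d := by simp [hm d, hn d]
  zero_mem' d := by simp
  smul_mem' a m hm d := by simp [hm d]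

theorem finrank_invariantFunctions_le :
    Module.finrank ℚ D.invariantFunctions ≤ D.numPieces := by
  let mk : D.Dart → D.Piece := Quotient.mk _
  have hfin : Finite D.Piece := Finite.of_surjective mk Quotient.mk_surjective
  have := Fintype.ofFinite D.Piece
  have h : D.invariantFunctions ≤ LinearMap.range (LinearMap.funLeft ℚ ℚ mk) := by
    intro m hm
    have hg (g : Equiv.Perm D.Dart) (hg : g ∈ Subgroup.closure {D.rotation, D.edgeFlip}) :
        ∀ d, m (g d) = m d := by
      induction hg using Subgroup.closure_induction with
      | mem g hg =>
        rcases hg with rfl | rfl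
        exacts [fun d => (hm d).1, fun d => (hm d).2]
      | one => exact fun d => rfl
      | mul g h _ _ ihg ihh => exact fun d => (ihg _).trans (ihh d)
      | inv g _ ih => exact fun d => (ih (g⁻¹ d)).symm.trans (congrArg m (g.apply_symm_apply d))
    refine ⟨fun P => Quotient.liftOn P m ?_, funext fun d => rfl⟩
    rintro a b ⟨g, rfl⟩
    exact hg g.1 g.2 b
  calc _ ≤ _ := Submodule.finrank_mono h
    _ ≤ Module.finrank ℚ (D.Piece → ℚ) := LinearMap.finrank_range_le _
    _ = D.numPieces := by
      rw [Module.finrank_fintype_fun_eq_card, numPieces, Nat.card_eq_fintype_card]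

/-- The differences of a function on the faces across the arcs. -/
def faceDifference : (D.Face → ℚ) →ₗ[ℚ] (D.Arc → ℚ) :=
  LinearMap.funLeft ℚ ℚ (fun p => D.face (.inl p)) -
    LinearMap.funLeft ℚ ℚ (fun p => D.face (.inr (D.next p)))

open Classical in
/-- The incidence matrix of the underlying graph. -/
noncomputable def incidence : Matrix (D.Pt ⊕ D.Xing) D.Arc ℚ :=
  fun v p => (if vertex p = v then 1 else 0) - (if vertex (D.next p) = v then 1 else 0)

/-- Pulling back along `f` embeds `S` into the functions that are constant on the pieces. This
serves both for faces and for vertices. -/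
theorem finrank_le_numPieces {A : Type} [Finite A] {f : D.Dart → A} (hf : Function.Surjective f)
    {S : Submodule ℚ (A → ℚ)}
    (hS : ∀ μ ∈ S, ∀ d, μ (f (D.rotation d)) = μ (f d) ∧ μ (f (D.edgeFlip d)) = μ (f d)) :
    Module.finrank ℚ S ≤ D.numPieces := by
  refine le_trans ?_ D.finrank_invariantFunctions_le
  rw [(Submodule.equivMapOfInjective _
    (LinearMap.funLeft_injective_of_surjective ℚ ℚ f hf) S).finrank_eq]
  exact Submodule.finrank_mono (Submodule.map_le_iff_le_comap.2 hS)

theorem finrank_ker_faceDifference_le :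
    Module.finrank ℚ (LinearMap.ker D.faceDifference) ≤ D.numPieces := by
  have hs : Function.Surjective D.face := Quotient.mk_surjective
  have hfin : Finite D.Face := Finite.of_surjective _ hs
  refine D.finrank_le_numPieces hs fun μ hμ => ?_
  have h (p) : μ (D.face (.inl p)) = μ (D.face (.inr (D.next p))) :=
    sub_eq_zero.1 (congrFun (LinearMap.mem_ker.1 hμ) p)
  have hflip (d) : μ (D.face (D.edgeFlip d)) = μ (D.face d) := by
    rcases d with p | p
    · exact (h p).symm
    · refine (h (D.next.symm p)).trans ?_
      rw [Equiv.apply_symm_apply]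
  exact fun d => ⟨by rw [← face_edgeFlip, hflip], hflip d⟩

theorem finrank_ker_incidence_transpose_le :
    Module.finrank ℚ (LinearMap.ker D.incidence.transpose.mulVecLin) ≤ D.numPieces := by
  have hs : Function.Surjective (Sum.elim vertex vertex : D.Dart → D.Pt ⊕ D.Xing) := by
    rintro (v | x)
    exacts [⟨.inl (.inl v), rfl⟩, ⟨.inl (.inr (x, true)), rfl⟩]
  refine D.finrank_le_numPieces hs fun ν hν => ?_
  have h (p) : ν (vertex p) = ν (vertex (D.next p)) := by
    have := congrFun (LinearMap.mem_ker.1 hν) p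
    rw [Matrix.mulVecLin_apply, Matrix.mulVec_transpose] at this
    simpa [Matrix.vecMul, dotProduct, incidence, mul_sub, Finset.sum_sub_distrib,
      sub_eq_zero] using this
  refine fun d => ⟨congrArg ν ?_, ?_⟩
  · rcases d with (v | ⟨x, _ | _⟩) | (v | ⟨x, _ | _⟩) <;> rfl
  · rcases d with p | p
    · exact (h p).symm
    · refine (h (D.next.symm p)).trans ?_
      rw [Equiv.apply_symm_apply]
      rfl

theorem incidence_mulVec (c : D.Arc → ℚ) (v : D.Pt ⊕ D.Xing) :
    D.incidence.mulVec c v = Sum.rec (motive := fun _ => ℚ)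
      (fun v => c (.inl v) - c (D.next.symm (.inl v)))
      (fun x => c (.inr (x, true)) - c (D.next.symm (.inr (x, true))) +
        (c (.inr (x, false)) - c (D.next.symm (.inr (x, false))))) v := by
  classical
  have h1 : ∑ p, (if vertex (D.next p) = v then c p else 0) =
      ∑ p, if vertex p = v then c (D.next.symm p) else 0 := by
    rw [← Equiv.sum_comp D.next (fun p => if vertex p = v then c (D.next.symm p) else 0)]
    simp only [Equiv.symm_apply_apply]
  simp only [Matrix.mulVec, dotProduct, incidence, sub_mul, Finset.sum_sub_distrib, ite_mul,
    one_mul, zero_mul, h1]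
  rw [Fintype.sum_sum_type, Fintype.sum_prod_type, Fintype.sum_sum_type, Fintype.sum_prod_type]
  rcases v with v | x
  · simp [vertex]
  · simp [vertex]
    ring

/-- Boundaries are cycles: around a vertex, the differences between consecutive faces telescope. -/
theorem range_faceDifference_le :
    LinearMap.range D.faceDifference ≤ LinearMap.ker D.incidence.mulVecLin := by
  rintro _ ⟨μ, rfl⟩
  refine LinearMap.mem_ker.2 (funext fun v => ?_)
  have hout (p) : D.faceDifference μ p =
      μ (D.face (.inl p)) - μ (D.face (D.rotation (.inl p))) := by
    rw [← face_edgeFlip]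
    rfl
  have hin (p) : D.faceDifference μ (D.next.symm p) =
      μ (D.face (D.rotation (.inr p))) - μ (D.face (.inr p)) := by
    rw [← face_edgeFlip]
    change _ - μ (D.face (.inr (D.next (D.next.symm p)))) = _
    rw [Equiv.apply_symm_apply]
    rfl
  rw [Matrix.mulVecLin_apply, incidence_mulVec]
  rcases v with v | x
  all_goals
    simp only [hin]
    simp only [hout, rotation, Equiv.coe_fn_mk, Pi.zero_apply]
    ring

variable {D}

/-- Genus zero means vanishing first homology. With V vertices, E arcs, F faces and c pieces, the
face differences have rank at least F - c, and the incidence matrix has rank at least V - c. Its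
kernel thus has dimension at most E - V + c, which is F - c by Euler's formula. -/
theorem IsPlanar.range_faceDifference (hD : D.IsPlanar) :
    LinearMap.range D.faceDifference = LinearMap.ker D.incidence.mulVecLin := by
  have hfin : Finite D.Face := Finite.of_surjective D.face Quotient.mk_surjective
  have := Fintype.ofFinite D.Face
  have h0 := LinearMap.finrank_range_add_finrank_ker D.faceDifference
  have h1 := LinearMap.finrank_range_add_finrank_ker D.incidence.mulVecLin
  have h2 := LinearMap.finrank_range_add_finrank_ker D.incidence.transpose.mulVecLin
  have h3 : Module.finrank ℚ (LinearMap.range D.incidence.transpose.mulVecLin) =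
    Module.finrank ℚ (LinearMap.range D.incidence.mulVecLin) := Matrix.rank_transpose D.incidence
  have h4 := D.finrank_ker_faceDifference_le
  have h5 := D.finrank_ker_incidence_transpose_le
  have h6 : Fintype.card D.Pt + Fintype.card D.Xing + D.numFaces =
    Fintype.card D.Arc + 2 * D.numPieces := hD
  have h7 : D.numFaces = Fintype.card D.Face := Nat.card_eq_fintype_card
  rw [Module.finrank_fintype_fun_eq_card] at h0 h1 h2
  rw [Fintype.card_sum] at h2
  exact Submodule.eq_of_le_of_finrank_le D.range_faceDifference_le (by omega)

/-- An Alexander numbering: an index of the arcs such that the two left ends of a crossing have the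
same index, and the right ends have the next index. -/
structure IsNumbering (D : PreDiagram) (l : D.Arc → ℤ) : Prop where
  point (v) : l (D.next.symm (.inl v)) = l (.inl v)
  left (x) : l (D.next.symm (.inr (x, false))) = l (.inr (x, false))
  right (x) : l (D.next.symm (.inr (x, true))) = l (.inr (x, false)) + 1
  out (x) : l (.inr (x, true)) = l (.inr (x, false)) + 1

/-- The arcs of a planar diagram have an Alexander numbering. -/
theorem IsPlanar.exists_isNumbering (hD : D.IsPlanar) : ∃ l, D.IsNumbering l := by
  -- The constant 1 is a cycle because each vertex has as many outgoing as incoming ends.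
  obtain ⟨μ, hμ⟩ : (1 : D.Arc → ℚ) ∈ LinearMap.range D.faceDifference := by
    rw [hD.range_faceDifference]
    refine LinearMap.mem_ker.2 (funext fun v => ?_)
    rw [Matrix.mulVecLin_apply, incidence_mulVec]
    rcases v with v | x <;> simp
  have hout (p) : μ (D.face (D.rotation (.inl p))) = μ (D.face (.inl p)) - 1 := by
    rw [← face_edgeFlip, eq_sub_iff_add_eq', ← eq_sub_iff_add_eq]
    exact (congrFun hμ p).symm
  have hin (p) : μ (D.face (D.rotation (.inr p))) = μ (D.face (.inr p)) + 1 := by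
    have : D.faceDifference μ (D.next.symm p) = 1 := congrFun hμ _
    rw [← face_edgeFlip, ← sub_eq_iff_eq_add', ← this]
    change _ = _ - μ (D.face (.inr (D.next (D.next.symm p))))
    rw [Equiv.apply_symm_apply]
    rfl
  have harc (p) : μ (D.face (.inl (D.next.symm p))) = μ (D.face (.inr p)) + 1 := by
    rw [← hin, ← face_edgeFlip]
    rfl
  -- The potential `μ` is only rational, but it jumps by exactly 1 across each arc, and the floor
  -- commutes with such shifts.
  refine ⟨fun p => ⌊μ (D.face (.inl p))⌋, ?_, ?_, ?_, ?_⟩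
  · intro v
    rw [harc, ← hin]
    rfl
  all_goals
    intro x
    have h1 : μ (D.face (.inr (.inr (x, true)))) = μ (D.face (.inr (.inr (x, false)))) + 1 :=
      hin (.inr (x, false))
    have h2 : μ (D.face (.inl (.inr (x, true)))) = μ (D.face (.inr (.inr (x, true)))) + 1 :=
      hin (.inr (x, true))
    have h3 : μ (D.face (.inl (.inr (x, false)))) = μ (D.face (.inl (.inr (x, true)))) - 1 :=
      hout (.inr (x, true))
    simp only [harc, h3, h2, h1, add_sub_cancel_right, Int.floor_add_one]

end PreDiagram

/-! ### Monomial substitutions in Laurent polynomials -/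

section Laurent

theorem eq_prod_unitVec (m : Multiplicative (Fin 3 → ℤ)) : m = ∏ i, unitVec i ^ (m.toAdd i) := by
  refine Multiplicative.toAdd.injective ?_
  rw [toAdd_prod]
  simp only [toAdd_zpow, unitVec, toAdd_ofAdd, ← Pi.single_smul, smul_eq_mul, mul_one]
  exact (Finset.univ_sum_single _).symm

/-- The homomorphism from `ℤ³` with given values at the generators. -/
def liftUnitVec {G : Type*} [CommGroup G] (g : Fin 3 → G) : Multiplicative (Fin 3 → ℤ) →* G where
  toFun m := ∏ i, g i ^ (m.toAdd i)
  map_one' := by simp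
  map_mul' m n := by simp [zpow_add, Finset.prod_mul_distrib]

theorem liftUnitVec_unitVec {G : Type*} [CommGroup G] (g : Fin 3 → G) (i : Fin 3) :
    liftUnitVec g (unitVec i) = g i := by
  change ∏ j, g j ^ ((Pi.single i 1 : Fin 3 → ℤ) j) = g i
  rw [Finset.prod_eq_single i]
  · simp
  · intro j _ hj
    simp [Pi.single_eq_of_ne hj]
  · simp

theorem hom_ext_unitVec {G : Type*} [CommGroup G] {f g : Multiplicative (Fin 3 → ℤ) →* G}
    (h : ∀ i, f (unitVec i) = g (unitVec i)) : f = g := by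
  refine MonoidHom.ext fun m => ?_
  rw [eq_prod_unitVec m]
  simp only [map_prod, map_zpow, h]

/-- The monomials as units of the ring of Laurent polynomials. -/
noncomputable def monomialUnit : Multiplicative (Fin 3 → ℤ) →* Laurentˣ :=
  (Units.map (MonoidAlgebra.of ℤ _)).comp (toUnits (G := Multiplicative (Fin 3 → ℤ))).toMonoidHom

theorem coe_monomialUnit (m : Multiplicative (Fin 3 → ℤ)) :
    (monomialUnit m : Laurent) = MonoidAlgebra.of ℤ _ m := rfl

/-- The substitution of monomials for the variables. -/
noncomputable def substitution (g : Fin 3 → Multiplicative (Fin 3 → ℤ)) : Laurent →+* Laurent :=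
  MonoidAlgebra.mapDomainRingHom ℤ (liftUnitVec g)

theorem substitution_of (g : Fin 3 → Multiplicative (Fin 3 → ℤ)) (m) :
    substitution g (MonoidAlgebra.of ℤ _ m) = MonoidAlgebra.of ℤ _ (liftUnitVec g m) := by
  simp [substitution]

theorem map_substitution_monomialUnit (g : Fin 3 → Multiplicative (Fin 3 → ℤ)) (i) :
    Units.map (substitution g : Laurent →* Laurent) (monomialUnit (unitVec i)) =
      monomialUnit (g i) := by
  refine Units.ext ?_
  change substitution g (MonoidAlgebra.of ℤ _ _) = _
  exact (substitution_of g _).trans (congrArg _ (liftUnitVec_unitVec g i))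

/-- Congruent substitutions have congruent values. -/
theorem dvd_sub_substitution {p : Laurent} {g : Fin 3 → Multiplicative (Fin 3 → ℤ)}
    (h : ∀ i, p ∣ (monomialUnit (unitVec i) : Laurent) - monomialUnit (g i)) (x : Laurent) :
    p ∣ x - substitution g x := by
  let mk : Laurent →+* Laurent ⧸ Ideal.span {p} := Ideal.Quotient.mk (Ideal.span {p})
  suffices hmk : mk = mk.comp (substitution g) by
    rw [← Ideal.mem_span_singleton, ← Ideal.Quotient.mk_eq_mk_iff_sub_mem]
    exact DFunLike.congr_fun hmk x
  -- Comparing in the unit group of the quotient makes agreement on the three variables sufficient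
  -- for all monomials, negative exponents included.
  have hhom : (Units.map mk.toMonoidHom).comp monomialUnit =
      (Units.map (mk.comp (substitution g)).toMonoidHom).comp monomialUnit := by
    refine hom_ext_unitVec (G := (Laurent ⧸ Ideal.span {p})ˣ) fun i => Units.ext ?_
    have := h i
    rw [← Ideal.mem_span_singleton, ← Ideal.Quotient.mk_eq_mk_iff_sub_mem] at this
    refine this.trans ?_
    rw [← map_substitution_monomialUnit]
    rfl
  refine MonoidAlgebra.ringHom_ext (fun r => ?_) fun m => ?_
  · exact RingHom.congr_fun (RingHom.ext_int (mk.comp MonoidAlgebra.singleOneRingHom)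
      ((mk.comp (substitution g)).comp MonoidAlgebra.singleOneRingHom)) r
  · exact congrArg Units.val (DFunLike.congr_fun hhom m)

/-- A factor theorem: the substitution solves `p = 0` for one variable, hence is the identity modulo
`p`. -/
theorem dvd_of_substitution_eq_zero {p : Laurent} {g : Fin 3 → Multiplicative (Fin 3 → ℤ)}
    (h : ∀ i, p ∣ (monomialUnit (unitVec i) : Laurent) - monomialUnit (g i)) {x : Laurent}
    (hx : substitution g x = 0) : p ∣ x := by
  simpa [hx] using dvd_sub_substitution h x

end Laurent

/-! ### The determinant of the colouring equations and its zeros -/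

namespace PreDiagram

section
variable {R : Type*} [CommRing R] (s t q : Rˣ) (D : PreDiagram)

open Classical in
/-- The matrix of the equations for colourings. -/
noncomputable def colourMatrix : Matrix D.Arc D.Arc R :=
  LinearMap.toMatrix' (D.colourMap s t q)

open Classical in
/-- The determinant of the equations for colourings. -/
noncomputable def colourDet : R := (D.colourMatrix s t q).det

open Classical in
theorem colourMatrix_apply (p a : D.Arc) : D.colourMatrix s t q p a =
    vertexOut s t q D.kind (fun p' => if D.next.symm p' = a then 1 else 0) p -
      if p = a then 1 else 0 := by
  rw [colourMatrix, LinearMap.toMatrix'_apply]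
  change vertexOut s t q D.kind _ p - _ = _
  congr 1
  · congr 1
    funext p'
    change (Pi.single a 1 : D.Arc → R) _ = _
    simp [Pi.single_apply]
  · simp [Pi.single_apply]

theorem colourDet_eq_zero_iff [IsDomain R] :
    D.colourDet s t q = 0 ↔ ∃ c ∈ D.colourings s t q, c ≠ 0 := by
  classical
  rw [colourDet, ← Matrix.exists_mulVec_eq_zero_iff]
  simp only [colourMatrix, LinearMap.toMatrix'_mulVec, colourings, LinearMap.mem_ker]
  exact ⟨fun ⟨c, h1, h2⟩ => ⟨c, by convert h2, h1⟩, fun ⟨c, h1, h2⟩ => ⟨c, h2, by convert h1⟩⟩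

theorem map_colourDet {S : Type*} [CommRing S] (φ : R →+* S) :
    φ (D.colourDet s t q) =
      D.colourDet (Units.map (φ : R →* S) s) (Units.map (φ : R →* S) t)
        (Units.map (φ : R →* S) q) := by
  classical
  rw [colourDet, colourDet, RingHom.map_det]
  congr 1
  ext p a
  rw [RingHom.mapMatrix_apply, Matrix.map_apply, colourMatrix_apply, colourMatrix_apply, map_sub]
  congr 1
  · rcases p with v | ⟨x, b⟩
    · simp [vertexOut, apply_ite φ]
    · simp only [vertexOut]
      cases D.kind x <;> cases b <;> simp [crossOut, ← map_inv, apply_ite φ]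
  · simp [apply_ite φ]

variable {s t q D}

/-- The powers of `s` given by an Alexander numbering are a colouring at `q = s`. -/
theorem IsNumbering.zpow_mem_colourings {l : D.Arc → ℤ} (hl : D.IsNumbering l) :
    (fun p => ((s ^ l p : Rˣ) : R)) ∈ D.colourings s t s := by
  rw [mem_colourings_iff]
  have hs := s.mul_inv
  have ht := t.mul_inv
  rintro (v | ⟨x, b⟩)
  · simp [vertexOut, hl.point]
  · simp only [vertexOut, hl.left, hl.right]
    cases D.kind x <;> cases b <;>
      simp only [crossOut, hl.out, zpow_add, zpow_one, Units.val_mul] <;> grind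

theorem IsPlanar.colourDet_eq_zero_left [IsDomain R] (hD : D.IsPlanar) (hne : Nonempty D.Arc) :
    D.colourDet s t s = 0 := by
  obtain ⟨l, hl⟩ := hD.exists_isNumbering
  refine (colourDet_eq_zero_iff _ _ _ _).2 ⟨_, hl.zpow_mem_colourings, fun h => ?_⟩
  exact (s ^ l hne.some).ne_zero (congrFun h hne.some)

/-- When `t = q⁻¹`, each vertex conserves the sum of its colours weighted by `q⁻¹ ^ l`. Summing over
all vertices counts every arc once as outgoing and once as incoming. -/
theorem IsNumbering.sum_zpow_mul_colourMap {l : D.Arc → ℤ} (hl : D.IsNumbering l)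
    (c : D.Arc → R) : ∑ p, ((q⁻¹ ^ l p : Rˣ) : R) * D.colourMap s q⁻¹ q c p = 0 := by
  have h : ∑ p, ((q⁻¹ ^ l p : Rˣ) : R) * c p =
      ∑ p, ((q⁻¹ ^ l (D.next.symm p) : Rˣ) : R) * c (D.next.symm p) :=
    (Equiv.sum_comp D.next.symm (fun p => ((q⁻¹ ^ l p : Rˣ) : R) * c p)).symm
  have h' (p) : D.colourMap s q⁻¹ q c p =
      vertexOut s q⁻¹ q D.kind (fun p' => c (D.next.symm p')) p - c p := rfl
  simp only [h', mul_sub, Finset.sum_sub_distrib, h]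
  rw [← Finset.sum_sub_distrib, Fintype.sum_sum_type, Fintype.sum_prod_type]
  have hq := q.mul_inv
  have hs := s.mul_inv
  rw [Finset.sum_eq_zero, Finset.sum_eq_zero, add_zero]
  · intro x _
    simp only [Fintype.sum_bool, vertexOut, hl.left, hl.right, hl.out, zpow_add, zpow_one,
      Units.val_mul]
    cases D.kind x <;> simp only [crossOut, inv_inv] <;> grind
  · intro v _
    simp [vertexOut, hl.point]

theorem IsPlanar.colourDet_eq_zero_right [IsDomain R] (hD : D.IsPlanar) (hne : Nonempty D.Arc) :
    D.colourDet s q⁻¹ q = 0 := by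
  classical
  obtain ⟨l, hl⟩ := hD.exists_isNumbering
  rw [colourDet, ← Matrix.exists_vecMul_eq_zero_iff]
  refine ⟨fun p => ((q⁻¹ ^ l p : Rˣ) : R), fun h => ?_, funext fun a => ?_⟩
  · exact (q⁻¹ ^ l hne.some).ne_zero (congrFun h hne.some)
  · simp only [Matrix.vecMul, dotProduct, colourMatrix, LinearMap.toMatrix'_apply]
    exact hl.sum_zpow_mul_colourMap _

theorem HasOneComponent.colourDet_eq_zero [IsDomain R] (hD : D.HasOneComponent)
    (hne : Nonempty D.Arc) : D.colourDet t⁻¹ t q = 0 := by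
  obtain ⟨c, hc⟩ := D.exists_unit_colouring hD t q
  exact (colourDet_eq_zero_iff _ _ _ _).2 ⟨_, hc, fun h => (c hne.some).ne_zero (congrFun h _)⟩

/-- Without virtual crossings, the equations for colourings do not involve `q`. -/
theorem colourDet_congr_of_classical (hD : ∀ x, D.kind x ≠ .virt) (q' : Rˣ) :
    D.colourDet s t q = D.colourDet s t q' := by
  classical
  rw [colourDet, colourDet]
  congr 1
  ext p a
  rw [colourMatrix_apply, colourMatrix_apply]
  congr 1
  rcases p with v | ⟨x, b⟩
  · rfl
  · simp only [vertexOut]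
    have := hD x
    cases h : D.kind x <;> cases b <;> simp_all [crossOut]

end

end PreDiagram

/-- The vanishing of the determinant is an invariant of virtual links. -/
theorem Diagram.colourDet_eq_zero_of_toLink_eq {R : Type*} [CommRing R] [IsDomain R] {s t q : Rˣ}
    {D E : Diagram} (h : D.toLink = E.toLink) (hE : E.colourDet s t q = 0) :
    D.colourDet s t q = 0 := by
  -- The invariant is a dimension over a field; the determinant is therefore moved to the fraction
  -- field, where it vanishes exactly when the colouring space is nonzero.
  let φ := algebraMap R (FractionRing R)
  have hφ : Function.Injective φ := IsFractionRing.injective R (FractionRing R)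
  rw [← map_eq_zero_iff φ hφ, PreDiagram.map_colourDet, PreDiagram.colourDet_eq_zero_iff,
    ← Submodule.ne_bot_iff, Ne, ← Submodule.finrank_eq_zero] at hE ⊢
  rwa [Diagram.finrank_colourings_eq h]


/-! ### Fox calculus over the Laurent polynomials -/

section Fox
variable {A : Type}

/-- The Fox derivative with values in the ring of Laurent polynomials. -/
noncomputable def laurentFox (g : Gen A) (w : FreeGroup (Gen A)) : Laurent :=
  MonoidAlgebra.mapDomainRingHom ℤ (abelianize A) (fox g w)

theorem foxWord_append {G : Type} (g : G) (u v : List (G × Bool)) :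
    foxWord g (u ++ v) = foxWord g u + MonoidAlgebra.of ℤ _ (FreeGroup.mk u) * foxWord g v := by
  induction u with
  | nil =>
    have : (FreeGroup.mk ([] : List (G × Bool))) = 1 := rfl
    simp only [List.nil_append, foxWord, this, map_one, one_mul, zero_add]
  | cons a u ih =>
    obtain ⟨h, _ | _⟩ := a
    · have hm : FreeGroup.mk ((h, false) :: u) = (FreeGroup.of h)⁻¹ * FreeGroup.mk u := rfl
      simp only [List.cons_append, foxWord, ih, hm, map_mul, mul_add, mul_assoc, add_assoc]
    · have hm : FreeGroup.mk ((h, true) :: u) = FreeGroup.of h * FreeGroup.mk u := rfl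
      simp only [List.cons_append, foxWord, ih, hm, map_mul, mul_add, mul_assoc, add_assoc]

theorem fox_mul {G : Type} (g : G) (u v : FreeGroup G) :
    fox g (u * v) = fox g u + MonoidAlgebra.of ℤ _ u * fox g v := by
  induction u using Quot.inductionOn
  induction v using Quot.inductionOn
  exact foxWord_append g _ _

theorem laurentFox_mul (g : Gen A) (u v : FreeGroup (Gen A)) :
    laurentFox g (u * v) =
      laurentFox g u + (monomialUnit (abelianize A u) : Laurent) * laurentFox g v := by
  rw [laurentFox, fox_mul, map_add, map_mul]
  simp [laurentFox, coe_monomialUnit]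

open Classical in
theorem laurentFox_of (g h : Gen A) :
    laurentFox g (FreeGroup.of h) = if h = g then 1 else 0 := by
  have : fox g (FreeGroup.of h) = foxWord g [(h, true)] := rfl
  rw [laurentFox, this]
  simp [foxWord, apply_ite]

theorem laurentFox_one (g : Gen A) : laurentFox g 1 = 0 := by
  have : fox g (1 : FreeGroup (Gen A)) = foxWord g [] := rfl
  rw [laurentFox, this, foxWord, map_zero]

theorem laurentFox_inv (g : Gen A) (u : FreeGroup (Gen A)) :
    laurentFox g u⁻¹ = -((monomialUnit (abelianize A u))⁻¹ : Laurentˣ) * laurentFox g u := by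
  have h := laurentFox_mul g u⁻¹ u
  rw [inv_mul_cancel, laurentFox_one, map_inv, map_inv] at h
  rw [neg_mul]
  exact eq_neg_of_add_eq_zero_left h.symm

/-- The generators as a finite type. -/
def genEquiv : Option (Option A) ≃ Gen A where
  toFun
    | none => .s
    | some none => .q
    | some (some a) => .arc a
  invFun
    | .s => none
    | .q => some none
    | .arc a => some (some a)
  left_inv := by rintro (_ | _ | a) <;> rfl
  right_inv := by rintro (a | _ | _) <;> rfl

noncomputable instance [Fintype A] : Fintype (Gen A) := Fintype.ofEquiv _ genEquiv

theorem card_gen [Fintype A] : Fintype.card (Gen A) = Fintype.card A + 2 := by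
  rw [← Fintype.card_congr genEquiv, Fintype.card_option, Fintype.card_option]

/-- The difference of a generator and `1`. -/
noncomputable def genDifference (g : Gen A) : Laurent :=
  monomialUnit (abelianize A (FreeGroup.of g)) - 1

/-- The fundamental identity of the Fox calculus. -/
theorem sum_laurentFox [Fintype A] (w : FreeGroup (Gen A)) :
    ∑ g, laurentFox g w * genDifference g = (monomialUnit (abelianize A w) : Laurent) - 1 := by
  classical
  induction w using FreeGroup.induction_on with
  | C1 => simp [laurentFox_one]
  | of h => simp [laurentFox_of, genDifference]
  | inv_of h ih =>
    have hu := (monomialUnit (abelianize A (FreeGroup.of h))).inv_mul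
    simp only [laurentFox_inv, mul_assoc, ← Finset.mul_sum, ih, map_inv]
    linear_combination -hu
  | mul u v ihu ihv =>
    simp only [laurentFox_mul, add_mul, Finset.sum_add_distrib, mul_assoc, ← Finset.mul_sum, ihu,
      ihv, map_mul, Units.val_mul]
    ring

end Fox

/-! ### The entries and the kernel of the Alexander matrix -/

namespace PreDiagram
variable (D : PreDiagram)

theorem abelianize_relator (r : Option D.Arc) : abelianize D.Arc (D.relator r) = 1 := by
  rcases r with _ | v | ⟨c, b⟩
  · simp [relator, abelianize]
  · simp [relator, abelianize]
  · refine Multiplicative.toAdd.injective ?_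
    simp only [relator]
    cases D.kind c <;> cases b <;> simp [abelianize] <;> abel

theorem alexanderMatrix_apply (r : Option D.Arc) (g : Gen D.Arc) :
    D.alexanderMatrix r g = laurentFox g (D.relator r) := rfl

/-- This is the fundamental identity for words of trivial abelianization. It supplies the linear
relation between the columns that ties all maximal minors together. -/
theorem alexanderMatrix_mulVec : D.alexanderMatrix.mulVec genDifference = 0 := by
  funext r
  have := sum_laurentFox (D.relator r)
  rw [abelianize_relator, map_one, Units.val_one, sub_self] at this
  exact this

/-- The determinant of the part of the matrix that belongs to the arcs. -/
noncomputable def alexanderDet : Laurent :=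
  D.colourDet (monomialUnit (unitVec 0)) (monomialUnit (unitVec 1)) (monomialUnit (unitVec 2))

/-- The rule `crossOut` was chosen to be the abelianized Fox derivative of the outgoing word. The
final inverse letter contributes -1, since the whole relator abelianizes to 1. -/
theorem alexanderMatrix_some_arc (p a : D.Arc) : D.alexanderMatrix (some p) (.arc a) =
    D.colourMatrix (monomialUnit (unitVec 0)) (monomialUnit (unitVec 1))
      (monomialUnit (unitVec 2)) p a := by
  classical
  rw [alexanderMatrix_apply, colourMatrix_apply]
  have hs : abelianize D.Arc (.of .s) = unitVec 0 := by simp [abelianize]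
  have ht (a) : abelianize D.Arc (.of (.arc a)) = unitVec 1 := by simp [abelianize]
  have hq : abelianize D.Arc (.of .q) = unitVec 2 := by simp [abelianize]
  have hs' := (monomialUnit (unitVec 0)).mul_inv
  have ht' := (monomialUnit (unitVec 1)).mul_inv
  have hq' := (monomialUnit (unitVec 2)).mul_inv
  rcases p with v | ⟨x, b⟩
  · simp [relator, laurentFox_mul, laurentFox_inv, laurentFox_of, ht, vertexOut, incoming,
      sub_eq_add_neg, neg_ite]
  · simp only [relator, vertexOut, incoming]
    cases D.kind x <;> cases b <;>
      simp only [laurentFox_mul, laurentFox_inv, laurentFox_of, hs, ht, hq, map_mul, map_inv,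
        Units.val_mul, crossOut, Gen.arc.injEq, reduceCtorEq, if_false] <;>
      split_ifs <;> grind

theorem alexanderMatrix_none_arc (a : D.Arc) : D.alexanderMatrix none (.arc a) = 0 := by
  classical
  rw [alexanderMatrix_apply]
  simp [relator, laurentFox_mul, laurentFox_inv, laurentFox_of]

theorem alexanderMatrix_none_s : D.alexanderMatrix none .s = 1 - varQ := by
  classical
  rw [alexanderMatrix_apply]
  have hs : abelianize D.Arc (.of .s) = unitVec 0 := by simp [abelianize]
  have hq : abelianize D.Arc (.of .q) = unitVec 2 := by simp [abelianize]
  have hs' := (monomialUnit (unitVec 0)).mul_inv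
  have : varQ = monomialUnit (unitVec 2) := rfl
  simp only [relator, laurentFox_mul, laurentFox_inv, laurentFox_of, hs, hq, map_mul, map_inv,
    Units.val_mul, reduceCtorEq, if_false, if_true, this]
  grind

theorem alexanderMatrix_none_q : D.alexanderMatrix none .q = varS - 1 := by
  classical
  rw [alexanderMatrix_apply]
  have hs : abelianize D.Arc (.of .s) = unitVec 0 := by simp [abelianize]
  have hq : abelianize D.Arc (.of .q) = unitVec 2 := by simp [abelianize]
  have hs' := (monomialUnit (unitVec 0)).mul_inv
  have hq' := (monomialUnit (unitVec 2)).mul_inv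
  have : varS = monomialUnit (unitVec 0) := rfl
  simp only [relator, laurentFox_mul, laurentFox_inv, laurentFox_of, hs, hq, map_mul, map_inv,
    Units.val_mul, reduceCtorEq, if_false, if_true, this]
  grind

end PreDiagram

/-! ### Maximal minors and the smallest principal ideal -/

section Minors
variable {R : Type*} [CommRing R]

open Matrix in
/-- If `k` is in the kernel of a matrix with one more column than rows, the maximal minors are
proportional to the entries of `k`. -/
theorem mul_det_submatrix_eq {n γ : Type*} [Fintype n] [DecidableEq n] [Fintype γ]
    (M : Matrix n γ R) {k : γ → R} (hk : M *ᵥ k = 0) (e : Option n ≃ γ) (i : n) :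
    k (e (some i)) * (M.submatrix id fun i => e (some i)).det =
      -k (e none) *
        ((M.submatrix id fun i => e (some i)).updateCol i fun r => M r (e none)).det := by
  set B := M.submatrix id fun i => e (some i) with hB
  have h : B *ᵥ (fun i => k (e (some i))) = -k (e none) • fun r => M r (e none) := by
    funext r
    have := congrFun hk r
    simp only [mulVec, dotProduct, ← e.sum_comp, Fintype.sum_option, Pi.zero_apply] at this
    rw [Pi.smul_apply, smul_eq_mul, neg_mul, mul_comm]
    exact eq_neg_of_add_eq_zero_right this
  -- Cramer's rule for `B`, whose solution vector is known from the kernel relation.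
  have h' := congrFun (congrArg B.cramer h) i
  rw [cramer_eq_adjugate_mulVec, mulVec_mulVec, adjugate_mul, smul_mulVec, one_mulVec,
    LinearMap.map_smul, Pi.smul_apply, Pi.smul_apply, cramer_apply, smul_eq_mul, smul_eq_mul,
    mul_comm] at h'
  exact h'

end Minors

namespace PreDiagram
variable (D : PreDiagram)

/-- The columns of the arcs and a further column `z`. -/
def columns (z : Gen D.Arc) : Option D.Arc → Gen D.Arc
  | none => z
  | some a => .arc a

open Classical in
-- The row of [s,q] is zero on the arcs, so the matrix is block triangular.
theorem det_submatrix_columns (z : Gen D.Arc) :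
    (D.alexanderMatrix.submatrix id (D.columns z)).det =
      D.alexanderDet * D.alexanderMatrix none z := by
  rw [← Matrix.det_submatrix_equiv_self (Equiv.optionEquivSumPUnit.{0, 0} D.Arc).symm]
  have : (D.alexanderMatrix.submatrix id (D.columns z)).submatrix
      (Equiv.optionEquivSumPUnit.{0, 0} D.Arc).symm (Equiv.optionEquivSumPUnit.{0, 0} D.Arc).symm =
      Matrix.fromBlocks (D.colourMatrix (monomialUnit (unitVec 0)) (monomialUnit (unitVec 1))
        (monomialUnit (unitVec 2))) (Matrix.of fun p _ => D.alexanderMatrix (some p) z) 0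
        (Matrix.of fun _ _ => D.alexanderMatrix none z) := by
    refine Matrix.ext ?_
    rintro (p | _) (a | _)
    · exact D.alexanderMatrix_some_arc p a
    · rfl
    · exact D.alexanderMatrix_none_arc a
    · rfl
  rw [this]
  refine (Matrix.det_fromBlocks_zero₂₁ _ _ _).trans (congrArg₂ _ ?_ (Matrix.det_unique _))
  rw [alexanderDet, colourDet]

theorem genDifference_s : genDifference (.s : Gen D.Arc) = varS - 1 := by
  simp [genDifference, abelianize, varS, coe_monomialUnit]

theorem of_injective : Function.Injective (MonoidAlgebra.of ℤ (Multiplicative (Fin 3 → ℤ))) :=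
  MonoidAlgebra.of_injective

theorem unitVec_ne_one (i : Fin 3) : unitVec i ≠ 1 := fun h => by
  have := congrFun (Multiplicative.ofAdd.injective h) i
  simp at this

theorem varS_sub_one_ne_zero : varS - 1 ≠ 0 := by
  rw [sub_ne_zero, varS, ← map_one (MonoidAlgebra.of ℤ (Multiplicative (Fin 3 → ℤ)))]
  exact of_injective.ne (unitVec_ne_one 0)

/-- The maximal minors that avoid the column of `s`. -/
theorem dvd_det_submatrix_columns (f : Fin (Fintype.card D.Arc + 1) ≃ Option D.Arc)
    (g : Fin (Fintype.card D.Arc + 1) → Option D.Arc) :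
    D.alexanderDet * (varS - 1) ∣
      (D.alexanderMatrix.submatrix f fun i => D.columns .q (g i)).det := by
  classical
  let B := D.alexanderMatrix.submatrix id (D.columns .q)
  -- Choosing columns is multiplication by a 0-1 matrix. Its determinant is the cofactor, whatever
  -- the order of the columns.
  have h : D.alexanderMatrix.submatrix f (fun i => D.columns .q (g i)) =
      B.submatrix f f * (1 : Matrix (Option D.Arc) (Option D.Arc) Laurent).submatrix f g := by
    rw [Matrix.submatrix_mul_equiv, mul_one]
    rfl
  rw [h, Matrix.det_mul, Matrix.det_submatrix_equiv_self, ← D.alexanderMatrix_none_q,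
    ← det_submatrix_columns]
  exact Dvd.intro _ (by convert rfl)

/-- All maximal minors are divisible by the determinant of the part of the arcs. -/
theorem alexanderDet_dvd_minor (f : Fin (Fintype.card D.Arc + 1) ↪ Option D.Arc)
    (g : Fin (Fintype.card D.Arc + 1) ↪ Gen D.Arc) :
    D.alexanderDet ∣ (D.alexanderMatrix.submatrix f g).det := by
  classical
  let f' : Fin (Fintype.card D.Arc + 1) ≃ Option D.Arc := Equiv.ofBijective f
    ((Fintype.bijective_iff_injective_and_card _).2 ⟨f.injective, by simp⟩)
  have key (g : Fin (Fintype.card D.Arc + 1) → Gen D.Arc) (hg : ∀ i, g i ≠ .s) :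
      D.alexanderDet * (varS - 1) ∣ (D.alexanderMatrix.submatrix f g).det := by
    have h (i) : ∃ o, D.columns .q o = g i := by
      cases hi : g i with
      | arc a => exact ⟨some a, rfl⟩
      | s => exact absurd hi (hg i)
      | q => exact ⟨none, rfl⟩
    choose o ho using h
    obtain rfl : (fun i => D.columns .q (o i)) = g := funext ho
    exact D.dvd_det_submatrix_columns f' o
  by_cases hs : ∃ i, g i = .s
  swap
  · exact (Dvd.intro _ rfl).trans (key g fun i hi => hs ⟨i, hi⟩)
  obtain ⟨i, hi⟩ := hs
  obtain ⟨j, hj⟩ : ∃ j, ∀ i, g i ≠ j := by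
    by_contra! h
    have := Fintype.card_le_of_surjective g h
    rw [card_gen, Fintype.card_fin] at this
    omega
  let e : Option (Fin (Fintype.card D.Arc + 1)) ≃ Gen D.Arc :=
    Equiv.ofBijective (fun o => o.elim j g) ((Fintype.bijective_iff_injective_and_card _).2 ⟨by
      rintro (_ | a) (_ | b) h
      · rfl
      · exact absurd h.symm (hj b)
      · exact absurd h (hj a)
      · exact congrArg some (g.injective h), by simp [card_gen]⟩)
  have hk : (D.alexanderMatrix.submatrix f id).mulVec genDifference = 0 :=
    funext fun r => congrFun D.alexanderMatrix_mulVec (f r)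
  -- Exactly one generator `j` is omitted. The kernel relation trades the column `s` for `j` at the
  -- cost of a factor s - 1 on the left; `key` produces the same factor on the right, and it
  -- cancels.
  have hprop := mul_det_submatrix_eq (D.alexanderMatrix.submatrix f id) hk e i
  have hupd : ((D.alexanderMatrix.submatrix f id).submatrix id fun i => e (some i)).updateCol i
      (fun r => D.alexanderMatrix.submatrix f id r (e none)) =
      D.alexanderMatrix.submatrix f (Function.update g i j) := by
    ext r c
    by_cases hc : c = i
    · subst hc
      simp [e]
    · simp [e, hc]
  rw [hupd] at hprop
  change genDifference (g i) * (D.alexanderMatrix.submatrix f g).det = _ at hprop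
  rw [hi, genDifference_s] at hprop
  obtain ⟨x, hx⟩ := key (Function.update g i j) fun c => by
    by_cases hc : c = i
    · subst hc
      rw [Function.update_self]
      exact fun h => hj c (hi.trans h.symm)
    · rw [Function.update_of_ne hc]
      exact fun h => hc (g.injective (h.trans hi.symm))
  refine ⟨-genDifference (e none) * x, mul_left_cancel₀ varS_sub_one_ne_zero ?_⟩
  rw [hprop, hx]
  ring

theorem elementaryIdeal_le : D.elementaryIdeal ≤ Ideal.span {D.alexanderDet} := by
  rw [elementaryIdeal, Ideal.span_le]
  rintro _ ⟨f, g, rfl⟩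
  exact Ideal.mem_span_singleton.2 (D.alexanderDet_dvd_minor f g)

theorem mul_mem_elementaryIdeal {z : Gen D.Arc} (hz : ∀ a, z ≠ .arc a) :
    D.alexanderDet * D.alexanderMatrix none z ∈ D.elementaryIdeal := by
  classical
  have hinj : Function.Injective (D.columns z) := by
    rintro (_ | a) (_ | b) h
    · rfl
    · exact absurd h (hz b)
    · exact absurd h.symm (hz a)
    · exact congrArg some (Gen.arc.inj h)
  let f : Fin (Fintype.card D.Arc + 1) ≃ Option D.Arc :=
    (Fintype.equivFinOfCardEq (by simp)).symm
  refine Ideal.subset_span ⟨f.toEmbedding, f.toEmbedding.trans ⟨_, hinj⟩, ?_⟩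
  rw [← det_submatrix_columns, ← Matrix.det_submatrix_equiv_self f]
  congr 1

/-- The substitution of `1` for `s`. -/
def oneForS : Fin 3 → Multiplicative (Fin 3 → ℤ) := ![1, unitVec 1, unitVec 2]

/-- At s = 1 the factor q - 1 stays nonzero in a domain, so `x` must vanish there. This is all the
coprimality that the greatest common divisor needs. -/
theorem varS_sub_one_dvd {x : Laurent} (h : varS - 1 ∣ x * (varQ - 1)) : varS - 1 ∣ x := by
  have hS : substitution oneForS varS = 1 := by
    rw [varS, substitution_of, liftUnitVec_unitVec]
    exact map_one _
  have hQ : substitution oneForS varQ = varQ := by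
    rw [varQ, substitution_of, liftUnitVec_unitVec]
    rfl
  refine dvd_of_substitution_eq_zero (g := oneForS) (fun i => ?_) ?_
  · fin_cases i
    · exact dvd_of_eq (by simp [oneForS, varS, coe_monomialUnit])
    · simp [oneForS]
    · simp [oneForS]
  · obtain ⟨y, hy⟩ := h
    have := congrArg (substitution oneForS) hy
    rw [map_mul, map_mul, map_sub, map_sub, hS, hQ, map_one, sub_self, zero_mul] at this
    refine (mul_eq_zero.1 this).resolve_right (sub_ne_zero.2 ?_)
    rw [varQ, ← map_one (MonoidAlgebra.of ℤ (Multiplicative (Fin 3 → ℤ)))]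
    exact of_injective.ne (unitVec_ne_one 2)

/-- The determinant of the part of the arcs generates the smallest principal ideal that contains the
maximal minors. -/
theorem isPrincipalHull_alexanderDet : IsPrincipalHull D.elementaryIdeal D.alexanderDet := by
  refine ⟨D.elementaryIdeal_le, fun f hf => ?_⟩
  rw [Ideal.span_singleton_le_span_singleton]
  obtain ⟨u, hu⟩ := Ideal.mem_span_singleton.1
    (hf (D.mul_mem_elementaryIdeal (z := .q) (by simp)))
  obtain ⟨v, hv⟩ := Ideal.mem_span_singleton.1
    (hf (D.mul_mem_elementaryIdeal (z := .s) (by simp)))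
  rw [alexanderMatrix_none_q] at hu
  rw [alexanderMatrix_none_s] at hv
  by_cases h0 : f = 0
  · subst h0
    rw [zero_mul] at hu
    rw [(mul_eq_zero.1 hu).resolve_right varS_sub_one_ne_zero]
  -- Eliminating Δ from Δ(s - 1) = fu and Δ(1 - q) = fv gives u(q - 1) = -(s - 1)v.
  obtain ⟨w, rfl⟩ : varS - 1 ∣ u := by
    refine varS_sub_one_dvd ⟨-v, mul_left_cancel₀ h0 ?_⟩
    linear_combination (-(varQ - 1)) * hu - (varS - 1) * hv
  refine ⟨w, mul_left_cancel₀ varS_sub_one_ne_zero ?_⟩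
  linear_combination hu

theorem map_alexanderDet (g : Fin 3 → Multiplicative (Fin 3 → ℤ)) :
    substitution g D.alexanderDet =
      D.colourDet (monomialUnit (g 0)) (monomialUnit (g 1)) (monomialUnit (g 2)) := by
  rw [alexanderDet, map_colourDet, map_substitution_monomialUnit, map_substitution_monomialUnit,
    map_substitution_monomialUnit]

/-! ### The divisors of the determinant -/

variable {D}

theorem IsPlanar.varQ_sub_varS_dvd (hD : D.IsPlanar) (hne : Nonempty D.Arc) :
    varQ - varS ∣ D.alexanderDet := by
  refine dvd_of_substitution_eq_zero (g := ![unitVec 0, unitVec 1, unitVec 0]) (fun i => ?_) ?_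
  · fin_cases i
    · simp
    · simp
    · exact dvd_of_eq rfl
  · rw [map_alexanderDet]
    exact hD.colourDet_eq_zero_left hne

theorem IsPlanar.one_sub_varT_mul_varQ_dvd (hD : D.IsPlanar) (hne : Nonempty D.Arc) :
    1 - varT * varQ ∣ D.alexanderDet := by
  refine dvd_of_substitution_eq_zero
    (g := ![unitVec 0, (unitVec 2)⁻¹, unitVec 2]) (fun i => ?_) ?_
  · fin_cases i
    · simp
    -- The congruence modulo 1 - tq is t - q⁻¹ = (1 - tq)(-q⁻¹).
    · refine ⟨-((monomialUnit (unitVec 2))⁻¹ : Laurentˣ), ?_⟩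
      have hq := (monomialUnit (unitVec 2)).mul_inv
      change (varT : Laurent) - (monomialUnit (unitVec 2)⁻¹ : Laurentˣ) = _
      change varQ * _ = 1 at hq
      rw [map_inv]
      linear_combination (-varT) * hq
    · simp
  · rw [map_alexanderDet]
    simp only [Matrix.cons_val, map_inv]
    exact hD.colourDet_eq_zero_right hne

theorem HasOneComponent.one_sub_varS_mul_varT_dvd (hD : D.HasOneComponent)
    (hne : Nonempty D.Arc) : 1 - varS * varT ∣ D.alexanderDet := by
  refine dvd_of_substitution_eq_zero
    (g := ![(unitVec 1)⁻¹, unitVec 1, unitVec 2]) (fun i => ?_) ?_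
  · fin_cases i
    · refine ⟨-((monomialUnit (unitVec 1))⁻¹ : Laurentˣ), ?_⟩
      have ht := (monomialUnit (unitVec 1)).mul_inv
      change (varS : Laurent) - (monomialUnit (unitVec 1)⁻¹ : Laurentˣ) = _
      change varT * _ = 1 at ht
      rw [map_inv]
      linear_combination (-varS) * ht
    · simp
    · simp
  · rw [map_alexanderDet]
    simp only [Matrix.cons_val, map_inv]
    exact hD.colourDet_eq_zero hne

theorem IsPlanar.alexanderDet_eq_zero (hD : D.IsPlanar) (hne : Nonempty D.Arc)
    (hcl : ∀ x, D.kind x ≠ .virt) : D.alexanderDet = 0 := by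
  rw [alexanderDet, colourDet_congr_of_classical hcl (monomialUnit (unitVec 0))]
  exact hD.colourDet_eq_zero_left hne

end PreDiagram
end VirtualLinks

theorem mainTheorem6 (K : VirtualLinks.VirtualLink) :
    (∃ H : VirtualLinks.Laurent, K.IsAlexanderPolynomial H) ∧
    ∀ H : VirtualLinks.Laurent, K.IsAlexanderPolynomial H →
      (VirtualLinks.varQ - VirtualLinks.varS ∣ H) ∧
      (1 - VirtualLinks.varT * VirtualLinks.varQ ∣ H) ∧
      (K.IsKnot → 1 - VirtualLinks.varS * VirtualLinks.varT ∣ H) ∧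
      (K.IsClassical → H = 0) := by
  constructor
  · obtain ⟨D, rfl⟩ := Quot.exists_rep K
    exact ⟨_, D, rfl, D.isPrincipalHull_alexanderDet⟩
  · rintro H ⟨D, rfl, hH⟩
    -- Minimality of the hull: a divisor of Δ spans a principal ideal that contains all the minors,
    -- hence also `H`.
    have hdvd {p : VirtualLinks.Laurent} (hp : p ∣ D.alexanderDet) : p ∣ H :=
      Ideal.span_singleton_le_span_singleton.1 (hH.2 p (D.elementaryIdeal_le.trans
        (Ideal.span_singleton_le_span_singleton.2 hp)))
    refine ⟨hdvd (D.planar.varQ_sub_varS_dvd D.nonempty),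
      hdvd (D.planar.one_sub_varT_mul_varQ_dvd D.nonempty), ?_, ?_⟩
    · rintro ⟨E, hE, hknot⟩
      exact hdvd ((VirtualLinks.Diagram.hasOneComponent_of_toLink_eq hE.symm
        hknot).one_sub_varS_mul_varT_dvd D.nonempty)
    · rintro ⟨E, hE, hcl⟩
      -- The diagram `D` that computes `H` may have virtual crossings; the vanishing is transported
      -- from the classical diagram `E`.
      have h0 : D.alexanderDet = 0 := VirtualLinks.Diagram.colourDet_eq_zero_of_toLink_eq hE.symm
        (E.planar.alexanderDet_eq_zero E.nonempty hcl)
      exact zero_dvd_iff.1 (hdvd (dvd_of_eq h0.symm))
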